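/- Let $(W,S)$ be a Coxeter system with $S=\{s_1,\dots,s_n\}$ finite, let $R$ be the set of all reflections (conjugates of elements of $S$), $l_R$ the word length with respect to $R$, and $w=s_1s_2\cdots s_n$. Let $[1,w]=\{u\in W: l_R(u)+l_R(u^{-1}w)=l_R(w)\}$. The interval complex $K_W$ is the $\Delta$-complex with one $d$-simplex $[x_1|\cdots|x_d]$ for every $d$-tuple of elements $x_i\in[1,w]\setminus\{1\}$ such that $x_1\cdots x_d\in[1,w]$ and $l_R(x_1)+\dots+l_R(x_d)=l_R(x_1\cdots x_d)$; its faces are $\partial_0=[x_2|\cdots|x_d]$, $\partial_i=[x_1|\cdots|x_ix_{i+1}|\cdots|x_d]$ for $0<i<d$, and $\partial_d=[x_1|\cdots|x_{d-1}]$. Let $\mathcal F(K_W)$ be its poset of cells. For $T\subseteq S$ let $W_T=\langle T\rangle$, let $w_T$ be the product of the elements of $T$ in the order induced by $s_1,\dots,s_n$, and let $K_{W_T}\subseteq K_W$ be the interval complex of $[1,w_T]$ in $W_T$, with respect to the reflections of $W_T$. Put $X_W''=\bigcup_{T\subsetneq S}K_{W_T}$. Let $\eta([x_1|\cdots|x_d])=d$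 if $x_1\cdots x_d=w$, and $d+1$ otherwise. The fiber components are the connected components of the fibers of $\eta$ in the Hasse diagram of $\mathcal F(K_W)$. Within a fiber component, for $x_1\cdots x_d=w$ the simplex $[x_2|\cdots|x_d]$ is the right neighbor of $[x_1|\cdots|x_d]$, which is the right neighbor of $[x_1|\cdots|x_{d-1}]$; a simplex $\tau$ is weakly to the right of $\sigma$ (and $\sigma$ weakly to the left of $\tau$) if $\tau$ is reached from $\sigma$ by finitely many (possibly zero) steps to the right neighbor. Let $K_W''$ be the union of all fiber components that intersect $X_W''$, and let $K_W'$ be the set of all simplices $\sigma$ of $K_W$ such that the fiber component of $\sigma$ contains a simplex of $X_W''$ weakly to the left of $\sigma$ and a simplex of $X_W''$ weakly to the right of $\sigma$. Then $K_W'\subseteq K_W''$ are subcomplexes of $K_W$, and $K_W''$ deformation retracts onto $K_W'$ (with the points of $K_W'$ fixed at all times). Moreover, there is a matching $\mathcal M$ of the Hasse diagram of $\mathcal F(K_W'')$ whose set of critical simplices is exactly $\mathcal F(K_W')$, such that every edge of $\mathcal M$ joins two simplices of the same fiber component; every edge $\tau\lessdot\sigma$ of $\mathcal M$ is regular ($\tau=\partial_i\sigma$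 for exactly one $i$); $\mathcal M$ is acyclic (there are no directed cycles in the Hasse diagram of $\mathcal F(K_W'')$ when edges of $\mathcal M$ are oriented upwards and all others downwards); and $\mathcal M$ is proper (from every simplex only finitely many simplices can be reached by directed paths in this oriented diagram). -/

import Mathlib

/-! ### Δ-complexes, their cells and their realization -/

/-- A Δ-complex, given by its sets of simplices and the face maps between them. -/
structure DeltaComplex where
  obj : ℕ → Type*
  face : ∀ {n : ℕ}, Fin (n + 2) → obj (n + 1) → obj n
  face_face : ∀ {n : ℕ} (i j : Fin (n + 2)) (x : obj (n + 2)), i ≤ j →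
    face i (face j.succ x) = face j (face i.castSucc x)

namespace DeltaComplex

universe u

/-- The (open) cells of a Δ-complex: one for each simplex. -/
@[ext]
structure Cell (X : DeltaComplex.{u}) where
  dim : ℕ
  simplex : X.obj dim

/-- `τ` is a facet of `σ`, i.e. `τ = ∂ᵢ σ` for some `i`. -/
inductive IsFacet (X : DeltaComplex.{u}) : X.Cell → X.Cell → Prop
  | mk {n : ℕ} (i : Fin (n + 2)) (σ : X.obj (n + 1)) : IsFacet X ⟨n, X.face i σ⟩ ⟨n + 1, σ⟩

theorem IsFacet.dim_eq {X : DeltaComplex.{u}} {τ σ : X.Cell} (h : X.IsFacet τ σ) :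
    σ.dim = τ.dim + 1 := by
  cases h; rfl

theorem eq_or_dim_lt {X : DeltaComplex.{u}} {τ σ : X.Cell}
    (h : Relation.ReflTransGen X.IsFacet τ σ) : τ = σ ∨ τ.dim < σ.dim := by
  induction h with
  | refl => exact Or.inl rfl
  | tail _ hbc ih =>
    have := hbc.dim_eq
    rcases ih with rfl | ih
    · right; omega
    · right; omega

/-- The poset of cells `ℱ(X)`: the closure of `τ` is contained in the closure of `σ` exactly when
`τ` is an iterated face of `σ`. -/
instance (X : DeltaComplex.{u}) : PartialOrder X.Cell where
  le τ σ := Relation.ReflTransGen X.IsFacet τ σ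
  le_refl _ := Relation.ReflTransGen.refl
  le_trans _ _ _ := Relation.ReflTransGen.trans
  le_antisymm a b hab hba := by
    rcases eq_or_dim_lt hab with h | h
    · exact h
    · rcases eq_or_dim_lt hba with h' | h'
      · exact h'.symm
      · omega

/-- The codimension-one face `τ` of `σ` is regular: the characteristic map of `σ` is a
homeomorphism over `τ`, which means that exactly one facet of the standard simplex is mapped
onto `τ`. -/
def IsRegularFace (X : DeltaComplex.{u}) (τ σ : X.Cell) : Prop :=
  ∃ (n : ℕ) (x : X.obj (n + 1)) (y : X.obj n),
    σ = ⟨n + 1, x⟩ ∧ τ = ⟨n, y⟩ ∧ ∃! i : Fin (n + 2), X.face i x = y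

/-- The disjoint union of one standard simplex for each simplex of `X`. -/
abbrev SimplexSum (X : DeltaComplex.{u}) : Type u :=
  Σ σ : X.Cell, stdSimplex ℝ (Fin (σ.dim + 1))

/-- The `i`-th facet of the standard simplex of `σ` is glued to the standard simplex of `∂ᵢ σ`. -/
inductive Glue (X : DeltaComplex.{u}) : X.SimplexSum → X.SimplexSum → Prop
  | mk {n : ℕ} (i : Fin (n + 2)) (σ : X.obj (n + 1)) (t : stdSimplex ℝ (Fin (n + 1))) :
      Glue X ⟨⟨n, X.face i σ⟩, t⟩ ⟨⟨n + 1, σ⟩, stdSimplex.map i.succAbove t⟩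

/-- The geometric realization `|X|`, with the quotient topology. -/
def Realization (X : DeltaComplex.{u}) : Type u := Quot X.Glue

instance (X : DeltaComplex.{u}) : TopologicalSpace X.Realization :=
  inferInstanceAs (TopologicalSpace (Quot X.Glue))

/-- The characteristic map `Δ^d → |X|` of a `d`-dimensional cell. -/
def charMap (X : DeltaComplex.{u}) (σ : X.Cell) (t : stdSimplex ℝ (Fin (σ.dim + 1))) :
    X.Realization :=
  Quot.mk X.Glue ⟨σ, t⟩

/-- The union in `|X|` of the closed simplices in `A`. A set `A` of cells is (the set of cells of)
a subcomplex if and only if it is a lower set; then this is the realization of the subcomplex. -/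
def carrier (X : DeltaComplex.{u}) (A : Set X.Cell) : Set X.Realization :=
  ⋃ σ ∈ A, Set.range (X.charMap σ)

end DeltaComplex

/-- `A` deformation retracts onto its subspace `B` (the points of `B` stay fixed at all times). -/
def DeformationRetractsOnto {X : Type*} [TopologicalSpace X] (A B : Set X) : Prop :=
  B ⊆ A ∧ ∃ r : C(A, A), (∀ a, (r a : X) ∈ B) ∧
    (ContinuousMap.id A).HomotopicRel r {a | (a : X) ∈ B}

/-! ### Acyclic matchings of posets -/

namespace PosetMatching

variable {P : Type*} [PartialOrder P]

/-- A matching of the Hasse diagram of `P`; the pair `(p, q)` stands for the edge `p ⋖ q`. -/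
def IsMatching (M : Set (P × P)) : Prop :=
  (∀ e ∈ M, e.1 ⋖ e.2) ∧
    ∀ e ∈ M, ∀ f ∈ M, e ≠ f → Disjoint ({e.1, e.2} : Set P) {f.1, f.2}

/-- `p` is critical if it does not lie on an edge of the matching. -/
def IsCritical (M : Set (P × P)) (p : P) : Prop :=
  ∀ e ∈ M, p ≠ e.1 ∧ p ≠ e.2

/-- The edges of the Hasse diagram oriented by the matching: upwards for edges in the matching and
downwards for all others. -/
def Arrow (M : Set (P × P)) (p q : P) : Prop :=
  (p, q) ∈ M ∨ (q ⋖ p ∧ (q, p) ∉ M)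

/-- There is no directed cycle. -/
def IsAcyclic (M : Set (P × P)) : Prop :=
  ∀ p, ¬ Relation.TransGen (Arrow M) p p

/-- Only finitely many elements can be reached from each element by a directed path. -/
def IsProper (M : Set (P × P)) : Prop :=
  ∀ p, {q | Relation.ReflTransGen (Arrow M) p q}.Finite

end PosetMatching

/-! ### Intervals in groups and interval complexes -/

namespace IntervalComplex

variable {G : Type*} [Group G]

/-- The length of `x` with respect to the generating set `R = R⁻¹`. -/
noncomputable def len (R : Set G) (x : G) : ℕ :=
  sInf {k | ∃ l : List G, (∀ r ∈ l, r ∈ R) ∧ l.prod = x ∧ l.length = k}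

/-- The interval `[1, g]` in the right Cayley graph. -/
def interval (R : Set G) (g : G) : Set G :=
  {x | len R x + len R (x⁻¹ * g) = len R g}

/-- `[x₁|⋯|x_d]` is a simplex of the interval complex of `[1, g]`. -/
def IsSimplex (R : Set G) (g : G) {d : ℕ} (x : Fin d → G) : Prop :=
  (∀ i, x i ∈ interval R g ∧ x i ≠ 1) ∧
    ∑ i, len R (x i) = len R (List.ofFn x).prod ∧
    (List.ofFn x).prod ∈ interval R g

/-- The faces of `[x₁|⋯|x_d]`, where `d = n + 1`: `∂₀` omits `x₁`; `∂ᵢ` with `0 < i < d` replaces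
`xᵢ, xᵢ₊₁` by their product; and `∂_d` omits `x_d`. (Note that `Fin.contractNth j` merges the
entries in positions `j` and `j + 1`, counted from `0`, and omits the last entry if `j` is the last
position.) -/
def tupleFace {n : ℕ} (i : Fin (n + 2)) (x : Fin (n + 1) → G) : Fin n → G :=
  Fin.cases (motive := fun _ => Fin n → G) (Fin.tail x)
    (fun j : Fin (n + 1) => Fin.contractNth j (· * ·) x) i

section facts

theorem tupleFace_zero {n : ℕ} (x : Fin (n + 1) → G) : tupleFace 0 x = Fin.tail x := rfl

theorem tupleFace_succ {n : ℕ} (j : Fin (n + 1)) (x : Fin (n + 1) → G) :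
    tupleFace j.succ x = Fin.contractNth j (· * ·) x := rfl

theorem tupleFace_last {n : ℕ} (x : Fin (n + 1) → G) :
    tupleFace (Fin.last (n + 1)) x = Fin.init x := by
  rw [← Fin.succ_last, tupleFace_succ]
  funext k
  rw [Fin.contractNth_apply_of_lt _ _ _ _ (by simp)]
  rfl

theorem partialProd_tupleFace {n : ℕ} (i : Fin (n + 2)) (x : Fin (n + 1) → G) (k : Fin (n + 1)) :
    Fin.partialProd (tupleFace i x) k =
      (Fin.partialProd x (i.succAbove 0))⁻¹ * Fin.partialProd x (i.succAbove k) := by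
  induction i using Fin.cases with
  | zero =>
    rw [tupleFace_zero, Fin.succAbove_zero_apply, Fin.succAbove_zero_apply, Fin.partialProd_succ',
      Fin.partialProd_succ', Fin.partialProd_zero]
    group
  | succ j =>
    rw [tupleFace_succ, Fin.partialProd_contractNth]
    simp

theorem partialProd_injective {n : ℕ} :
    Function.Injective (Fin.partialProd : (Fin n → G) → Fin (n + 1) → G) := by
  intro x y h
  funext k
  rw [← Fin.partialProd_right_inv x k, ← Fin.partialProd_right_inv y k, h]

theorem tupleFace_tupleFace {n : ℕ} (i j : Fin (n + 2)) (x : Fin (n + 2) → G) (h : i ≤ j) :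
    tupleFace i (tupleFace j.succ x) = tupleFace j (tupleFace i.castSucc x) := by
  have key : ∀ k : Fin (n + 1), j.succ.succAbove (i.succAbove k) =
      i.castSucc.succAbove (j.succAbove k) := by
    intro k
    ext
    simp only [Fin.succAbove, Fin.lt_def, Fin.le_def] at *
    split_ifs <;> simp_all <;> omega
  apply partialProd_injective
  funext k
  simp only [partialProd_tupleFace, key]
  group

variable {R : Set G}

theorem len_le {x : G} (l : List G) (hl : ∀ r ∈ l, r ∈ R) (hx : l.prod = x) :
    len R x ≤ l.length :=
  Nat.sInf_le ⟨l, hl, hx, rfl⟩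

theorem len_one : len R (1 : G) = 0 := by
  simpa using len_le (R := R) (x := (1 : G)) [] (by simp) (by simp)

theorem exists_word (hgen : Submonoid.closure R = ⊤)
    (x : G) : ∃ l : List G, (∀ r ∈ l, r ∈ R) ∧ l.prod = x ∧ l.length = len R x := by
  apply Nat.sInf_mem (s := {k | ∃ l : List G, (∀ r ∈ l, r ∈ R) ∧ l.prod = x ∧ l.length = k})
  obtain ⟨l, hl, hx⟩ := Submonoid.exists_list_of_mem_closure
    (show x ∈ Submonoid.closure R by rw [hgen]; trivial)
  exact ⟨_, l, hl, hx, rfl⟩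

theorem len_mul_le (hgen : Submonoid.closure R = ⊤)
    (x y : G) : len R (x * y) ≤ len R x + len R y := by
  obtain ⟨l, hl, hx, hlx⟩ := exists_word hgen x
  obtain ⟨m, hm, hy, hmy⟩ := exists_word hgen y
  rw [← hlx, ← hmy, ← List.length_append]
  refine len_le _ (fun r hr => ?_) (by simp [hx, hy])
  rcases List.mem_append.1 hr with h | h
  · exact hl r h
  · exact hm r h

theorem eq_one_of_len (hgen : Submonoid.closure R = ⊤)
    {x : G} (h : len R x = 0) : x = 1 := by
  obtain ⟨l, _, hx, hlx⟩ := exists_word hgen x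
  rw [h, List.length_eq_zero_iff] at hlx
  rw [← hx, hlx, List.prod_nil]

theorem len_conj_le (hgen : Submonoid.closure R = ⊤)
    (hconj : ∀ r ∈ R, ∀ u : G, u * r * u⁻¹ ∈ R)
    (u x : G) : len R (u * x * u⁻¹) ≤ len R x := by
  obtain ⟨l, hl, hx, hlx⟩ := exists_word hgen x
  rw [← hlx, ← List.length_map (f := MulAut.conj u)]
  refine len_le _ (fun r hr => ?_) ?_
  · obtain ⟨s, hs, rfl⟩ := List.mem_map.1 hr
    exact hconj s (hl s hs) u
  · rw [← map_list_prod, hx]; rfl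

theorem partialProd_last {n : ℕ} (x : Fin n → G) :
    Fin.partialProd x (Fin.last n) = (List.ofFn x).prod := by
  simp [Fin.partialProd, List.take_of_length_le]

theorem partialSum_last {n : ℕ} (f : Fin n → ℕ) :
    Fin.partialSum f (Fin.last n) = ∑ i, f i := by
  simp [Fin.partialSum, List.take_of_length_le, List.sum_ofFn]

theorem len_partialProd_le (hgen : Submonoid.closure R = ⊤)
    {d : ℕ} (x : Fin d → G) (i j : Fin (d + 1)) (hij : i ≤ j) :
    Fin.partialSum (fun k => len R (x k)) i +
      len R ((Fin.partialProd x i)⁻¹ * Fin.partialProd x j) ≤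
      Fin.partialSum (fun k => len R (x k)) j := by
  induction j using Fin.induction with
  | zero =>
    obtain rfl : i = 0 := le_antisymm hij (Fin.zero_le _)
    simp [len_one]
  | succ j ih =>
    rcases hij.eq_or_lt with rfl | h
    · simp [len_one]
    · have := ih (Fin.le_castSucc_iff.2 h)
      rw [Fin.partialSum_succ, Fin.partialProd_succ, ← mul_assoc]
      have := len_mul_le hgen ((Fin.partialProd x i)⁻¹ * Fin.partialProd x j.castSucc) (x j)
      omega

theorem len_partialProd_eq (hgen : Submonoid.closure R = ⊤)
    {d : ℕ} {x : Fin d → G}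
    (hx : ∑ i, len R (x i) = len R (List.ofFn x).prod) (i j : Fin (d + 1)) (hij : i ≤ j) :
    Fin.partialSum (fun k => len R (x k)) i +
      len R ((Fin.partialProd x i)⁻¹ * Fin.partialProd x j) =
      Fin.partialSum (fun k => len R (x k)) j := by
  rw [← partialSum_last, ← partialProd_last] at hx
  have h1 := len_partialProd_le hgen x i j hij
  have h2 := len_partialProd_le hgen x 0 i (Fin.zero_le _)
  have h3 := len_partialProd_le hgen x j (Fin.last d) (Fin.le_last _)
  have h4 := len_mul_le hgen (Fin.partialProd x i) ((Fin.partialProd x i)⁻¹ * Fin.partialProd x j)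
  have h5 := len_mul_le hgen (Fin.partialProd x j)
    ((Fin.partialProd x j)⁻¹ * Fin.partialProd x (Fin.last d))
  simp only [mul_inv_cancel_left, Fin.partialProd_zero, Fin.partialSum_zero, inv_one, one_mul]
    at *
  omega

theorem mem_interval_of_le (hgen : Submonoid.closure R = ⊤)
    (hconj : ∀ r ∈ R, ∀ u : G, u * r * u⁻¹ ∈ R)
    {d : ℕ} {g : G} {x : Fin d → G} (hx : IsSimplex R g x)
    (i j : Fin (d + 1)) (hij : i ≤ j) :
    (Fin.partialProd x i)⁻¹ * Fin.partialProd x j ∈ interval R g := by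
  obtain ⟨-, hs, hm⟩ := hx
  have h1 := len_partialProd_eq hgen hs i j hij
  have h2 := len_partialProd_eq hgen hs 0 i (Fin.zero_le _)
  have h3 := len_partialProd_eq hgen hs j (Fin.last d) (Fin.le_last _)
  rw [← partialSum_last, ← partialProd_last] at hs
  rw [← partialProd_last] at hm
  simp only [Fin.partialProd_zero, Fin.partialSum_zero, inv_one, one_mul, interval,
    Set.mem_ofPred_eq] at *
  set p := Fin.partialProd x i
  set q := Fin.partialProd x j
  set e := Fin.partialProd x (Fin.last d)
  have h4 := len_mul_le hgen (p⁻¹ * q) ((p⁻¹ * q)⁻¹ * g)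
  have h5 := len_mul_le hgen ((p⁻¹ * q)⁻¹ * p * ((p⁻¹ * q)⁻¹)⁻¹) (q⁻¹ * g)
  have h6 := len_conj_le hgen hconj ((p⁻¹ * q)⁻¹) p
  have h7 := len_mul_le hgen (q⁻¹ * e) (e⁻¹ * g)
  have e1 : (p⁻¹ * q)⁻¹ * p * ((p⁻¹ * q)⁻¹)⁻¹ * (q⁻¹ * g) = (p⁻¹ * q)⁻¹ * g := by group
  have e2 : q⁻¹ * e * (e⁻¹ * g) = q⁻¹ * g := by group
  rw [e1] at h5
  rw [e2] at h7
  rw [mul_inv_cancel_left] at h4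
  omega

/-- Faces of simplices are simplices. -/
theorem IsSimplex.tupleFace (hgen : Submonoid.closure R = ⊤)
    (hconj : ∀ r ∈ R, ∀ u : G, u * r * u⁻¹ ∈ R)
    {n : ℕ} {g : G} {x : Fin (n + 1) → G} (hx : IsSimplex R g x)
    (i : Fin (n + 2)) : IsSimplex R g (tupleFace i x) := by
  have hs := hx.2.1
  have hmono : ∀ a b : Fin (n + 1), a ≤ b → i.succAbove a ≤ i.succAbove b :=
    fun a b h => (Fin.strictMono_succAbove i).monotone h
  have hy : ∀ k : Fin n, IntervalComplex.tupleFace i x k =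
      (Fin.partialProd x (i.succAbove k.castSucc))⁻¹ *
        Fin.partialProd x (i.succAbove k.succ) := by
    intro k
    rw [← Fin.partialProd_right_inv (IntervalComplex.tupleFace i x) k, partialProd_tupleFace,
      partialProd_tupleFace]
    group
  have hL : ∀ k : Fin n, Fin.partialSum (fun k => len R (x k)) (i.succAbove k.castSucc) +
      len R (IntervalComplex.tupleFace i x k) =
      Fin.partialSum (fun k => len R (x k)) (i.succAbove k.succ) := fun k => by
    rw [hy]
    exact len_partialProd_eq hgen hs _ _ (hmono _ _ (Fin.castSucc_lt_succ).le)
  have hlt : StrictMono (Fin.partialSum (fun k => len R (x k))) := by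
    rw [Fin.strictMono_iff_lt_succ]
    intro k
    rw [Fin.partialSum_succ]
    have : len R (x k) ≠ 0 := fun h => (hx.1 k).2 (eq_one_of_len hgen h)
    omega
  refine ⟨fun k => ⟨?_, fun h => ?_⟩, ?_, ?_⟩
  · rw [hy]
    exact mem_interval_of_le hgen hconj hx _ _ (hmono _ _ (Fin.castSucc_lt_succ).le)
  · have h1 := hL k
    have h2 := hlt (Fin.strictMono_succAbove i (Fin.castSucc_lt_succ (i := k)))
    rw [h, len_one] at h1
    omega
  · have tel : ∀ k : Fin (n + 1), Fin.partialSum (fun k => len R (x k)) (i.succAbove 0) +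
        Fin.partialSum (fun k => len R (IntervalComplex.tupleFace i x k)) k =
        Fin.partialSum (fun k => len R (x k)) (i.succAbove k) := by
      intro k
      induction k using Fin.induction with
      | zero => simp
      | succ k ih =>
        have := hL k
        rw [Fin.partialSum_succ]
        omega
    have h1 := tel (Fin.last n)
    have h2 := len_partialProd_eq hgen hs (i.succAbove 0) (i.succAbove (Fin.last n))
      (hmono _ _ (Fin.zero_le _))
    rw [← partialSum_last, ← partialProd_last, partialProd_tupleFace]
    omega
  · rw [← partialProd_last, partialProd_tupleFace]
    exact mem_interval_of_le hgen hconj hx _ _ (hmono _ _ (Fin.zero_le _))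

end facts

/-- The interval complex associated with `[1, g]`, for a generating set `R` closed under
conjugation (in particular, `[1, g]` is balanced). -/
def complex (R : Set G) (hgen : Submonoid.closure R = ⊤)
    (hconj : ∀ r ∈ R, ∀ u : G, u * r * u⁻¹ ∈ R) (g : G) : DeltaComplex where
  obj d := {x : Fin d → G // IsSimplex R g x}
  face i x := ⟨tupleFace i x.1, IsSimplex.tupleFace hgen hconj x.2 i⟩
  face_face i j x h := Subtype.ext (tupleFace_tupleFace i j x.1 h)

end IntervalComplex

/-! ### The interval complex of a Coxeter group and its subcomplexes -/

namespace DualCoxeter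

open IntervalComplex

variable {n : ℕ} {M : CoxeterMatrix (Fin n)} {W : Type*} [Group W] (cs : CoxeterSystem M W)

/-- The set of all reflections of `W`, i.e. the conjugates of the simple reflections. -/
def reflections : Set W := {r | cs.IsReflection r}

theorem closure_reflections : Submonoid.closure (reflections cs) = ⊤ := by
  rw [eq_top_iff, ← cs.submonoid_closure_range_simple]
  apply Submonoid.closure_mono
  rintro _ ⟨i, rfl⟩
  exact cs.isReflection_simple i

theorem conj_mem_reflections : ∀ r ∈ reflections cs, ∀ u : W, u * r * u⁻¹ ∈ reflections cs :=
  fun _ hr u => CoxeterSystem.IsReflection.conj hr u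

/-- The Coxeter element `w = s₁ s₂ ⋯ sₙ`. -/
def coxeterElement : W := (List.ofFn cs.simple).prod

/-- The interval complex `K_W` associated with `[1, w]`. -/
def K : DeltaComplex :=
  complex (reflections cs) (closure_reflections cs) (conj_mem_reflections cs) (coxeterElement cs)

/-- The standard parabolic subgroup `W_T`. -/
def parabolic (T : Finset (Fin n)) : Subgroup W := Subgroup.closure (cs.simple '' (T : Set (Fin n)))

/-- The set of reflections of the Coxeter group `W_T`: the conjugates in `W_T` of the elements
of `T`. -/
def parabolicReflections (T : Finset (Fin n)) : Set (parabolic cs T) :=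
  {r | ∃ u : parabolic cs T, ∃ i ∈ T, (r : W) = u * cs.simple i * (u : W)⁻¹}

/-- The Coxeter element `w_T` of `W_T`: the product of the elements of `T` in increasing order. -/
def parabolicCoxeterElement (T : Finset (Fin n)) : parabolic cs T :=
  ⟨((T.sort (· ≤ ·)).map cs.simple).prod, Subgroup.list_prod_mem _ (by
    intro x hx
    obtain ⟨i, hi, rfl⟩ := List.mem_map.1 hx
    exact Subgroup.subset_closure ⟨i, by simpa using hi, rfl⟩)⟩

/-- The cells of `K_W` that belong to the interval complex `K_{W_T}` associated with the
interval `[1, w_T]` in `W_T`. -/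
def parabolicCells (T : Finset (Fin n)) : Set (K cs).Cell :=
  {σ | ∃ y : Fin σ.dim → parabolic cs T,
    IsSimplex (parabolicReflections cs T) (parabolicCoxeterElement cs T) y ∧
      ∀ i, (y i : W) = σ.simplex.1 i}

/-- The subcomplex `X_W''`, the union of all `K_{W_T}` with `T` a proper subset of `S`. -/
def X'' : Set (K cs).Cell := {σ | ∃ T : Finset (Fin n), T ≠ Finset.univ ∧ σ ∈ parabolicCells cs T}

open Classical in
/-- `η([x₁|⋯|x_d])` is `d` if `x₁ ⋯ x_d = w`, and `d + 1` otherwise. -/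
noncomputable def eta (σ : (K cs).Cell) : ℕ :=
  if (List.ofFn σ.simplex.1).prod = coxeterElement cs then σ.dim else σ.dim + 1

/-- `σ` and `τ` lie in the same fiber component: they are connected in the subgraph of the Hasse
diagram of `ℱ(K_W)` induced on a fiber of `η`. -/
def SameFiberComponent (σ τ : (K cs).Cell) : Prop :=
  Relation.ReflTransGen
    (fun a b => (SimpleGraph.hasse (K cs).Cell).Adj a b ∧ eta cs a = eta cs b) σ τ

/-- The immediate neighbor to the right in a fiber component: for `x₁ ⋯ x_d = w`, the simplex
`[x₂|⋯|x_d]` comes right after `[x₁|⋯|x_d]`, which comes right after `[x₁|⋯|x_{d-1}]`. -/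
inductive StepRight : (K cs).Cell → (K cs).Cell → Prop
  | dropFirst {d : ℕ} (σ : (K cs).obj (d + 1)) (h : (List.ofFn σ.1).prod = coxeterElement cs) :
      StepRight ⟨d + 1, σ⟩ ⟨d, (K cs).face 0 σ⟩
  | addLast {d : ℕ} (σ : (K cs).obj (d + 1)) (h : (List.ofFn σ.1).prod = coxeterElement cs) :
      StepRight ⟨d, (K cs).face (Fin.last (d + 1)) σ⟩ ⟨d + 1, σ⟩

/-- `τ` is weakly to the right of `σ` in its fiber component. -/
def WeaklyRight (σ τ : (K cs).Cell) : Prop := Relation.ReflTransGen (StepRight cs) σ τ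

/-- `K_W'`: all simplices `σ` such that there is a simplex of `X_W''` both weakly to the left and
weakly to the right of `σ` in its fiber component. -/
def K' : Set (K cs).Cell :=
  {σ | (∃ ρ ∈ X'' cs, WeaklyRight cs ρ σ) ∧ (∃ ρ ∈ X'' cs, WeaklyRight cs σ ρ)}

/-- `K_W''`: the union of all fiber components that intersect `X_W''`. -/
def K'' : Set (K cs).Cell := {σ | ∃ ρ ∈ X'' cs, SameFiberComponent cs σ ρ}

end DualCoxeter

/-! Passing to a facet never increases η. It keeps η only when the product of the simplex is w and
the facet is ∂₀ or the last one. Both of these facets have product different from w, and each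
determines the simplex among those with product w. So the fiber components are directed lines or
cycles on which "high" simplices (product w) and low ones alternate (`isLineGraph`). Simplices of
X_W'' are low because w lies in no proper W_T: in the geometric representation, among the simple
reflections only s_i changes the i-th coordinate, and w contains s_i exactly once
(`coxeterElement_notMem_parabolic`).

In a component that meets X_W'', the part in K_W' lies between simplices of X_W''. What remains are
tails, possibly infinite. A tail begins with a high simplex next to X_W'', so each high simplex can
be matched with the low one following it away from X_W''. A cycle that meets X_W'' lies entirely in
K_W'. Arrows inside a fiber run towards X_W'' on the tails and merely from high to low in K_W'; all
other arrows lower η. So the arrow relation is well-founded (`wellFounded_arrow`), and since each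
simplex has finitely many facets the matching is also proper. Both sets of cells are subcomplexes by
an induction on dimension that follows the steps (`isLowerSet_reaches`).

For the deformation, give each cell as rank the finite number of cells reachable from it. A matched
pair collapses linearly away from its free face, at rank r during the times from 2⁻ʳ to 2¹⁻ʳ. Every
cell thus rests for a positive initial time and everything is finished at time 1, even though the
ranks may be unbounded. Continuity is checked on closed simplices
(`Collapse.deformationRetractsOnto`). -/

namespace stdSimplex

/-! ### Facets of the standard simplex in barycentric coordinates -/

theorem map_apply_of_injective {m n : ℕ} {f : Fin m → Fin n} (hf : Function.Injective f)
    (t : stdSimplex ℝ (Fin m)) (k : Fin m) : map f t (f k) = t k := by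
  rw [map_coe, FunOnFinite.linearMap_apply_apply, Finset.sum_eq_single k]
  · intro b hb hbk
    exact absurd (hf (Finset.mem_filter.1 hb).2) hbk
  · simp

theorem map_succAbove_apply {n : ℕ} (i : Fin (n + 2)) (t : stdSimplex ℝ (Fin (n + 1)))
    (k : Fin (n + 1)) : map i.succAbove t (i.succAbove k) = t k :=
  map_apply_of_injective Fin.succAbove_right_injective t k

theorem map_succAbove_apply_self {n : ℕ} (i : Fin (n + 2)) (t : stdSimplex ℝ (Fin (n + 1))) :
    map i.succAbove t i = 0 := by
  rw [map_coe, FunOnFinite.linearMap_apply_apply, Finset.sum_eq_zero]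
  intro b hb
  exact absurd (Finset.mem_filter.1 hb).2 (Fin.succAbove_ne i b)

theorem map_succAbove_injective {n : ℕ} (i : Fin (n + 2)) :
    Function.Injective (map (S := ℝ) i.succAbove) := by
  intro s t h
  ext k
  rw [← map_succAbove_apply i s, ← map_succAbove_apply i t, h]

theorem exists_map_succAbove_eq {n : ℕ} (i : Fin (n + 2)) {s : stdSimplex ℝ (Fin (n + 2))}
    (h : s i = 0) : ∃ t, map i.succAbove t = s := by
  refine ⟨⟨fun k => s (i.succAbove k), fun k => s.2.1 _, ?_⟩, ?_⟩
  · have := sum_eq_one s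
    rwa [Fin.sum_univ_succAbove _ i, h, zero_add] at this
  · ext k
    rcases Fin.eq_self_or_eq_succAbove i k with rfl | ⟨k, rfl⟩
    · rw [map_succAbove_apply_self, h]
    · rw [map_succAbove_apply]; rfl

theorem map_invFun_succAbove {n : ℕ} (i : Fin (n + 2)) (t : stdSimplex ℝ (Fin (n + 1))) :
    map (Function.invFun i.succAbove) (map i.succAbove t) = t := by
  rw [map_comp_apply, Function.invFun_comp Fin.succAbove_right_injective, map_id_apply]

end stdSimplex

/-! ### Identified points and closed sets in the realization -/

namespace DeltaComplex

universe u

variable {X : DeltaComplex.{u}}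

/-- Passing to two different facets in either order. -/
theorem exists_succAbove_comm {n : ℕ} {i j : Fin (n + 3)} (hij : i ≠ j) :
    ∃ i' j' : Fin (n + 2), i.succAbove i' = j ∧ j.succAbove j' = i ∧
      (∀ k, i.succAbove (i'.succAbove k) = j.succAbove (j'.succAbove k)) ∧
      ∀ (X : DeltaComplex.{u}) (x : X.obj (n + 2)),
        X.face i' (X.face i x) = X.face j' (X.face j x) := by
  wlog h : i < j generalizing i j
  · obtain ⟨i', j', h1, h2, h3, h4⟩ := this hij.symm (lt_of_le_of_ne (not_lt.1 h) hij.symm)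
    exact ⟨j', i', h2, h1, fun k => (h3 k).symm, fun X x => (h4 X x).symm⟩
  obtain ⟨j', rfl⟩ : ∃ j', Fin.succ j' = j := ⟨j.pred (by rintro rfl; simp at h), by simp⟩
  obtain ⟨i', rfl⟩ : ∃ i', Fin.castSucc i' = i :=
    ⟨i.castPred (by rintro rfl; simp [Fin.lt_def] at h; omega), by simp⟩
  have hle : i' ≤ j' := by
    have := Fin.lt_def.1 h
    rw [Fin.val_castSucc, Fin.val_succ] at this
    exact Fin.le_def.2 (by omega)
  refine ⟨j', i', ?_, ?_, ?_, fun X x => (X.face_face i' j' x hle).symm⟩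
  · rw [Fin.succAbove_of_le_castSucc _ _ (Fin.castSucc_le_castSucc_iff.2 hle)]
  · rw [Fin.succAbove_of_castSucc_lt _ _ h]
  · intro k
    ext
    simp only [Fin.succAbove, Fin.lt_def, Fin.le_def] at *
    split_ifs <;> simp_all <;> omega

/-- A point on a facet of a standard simplex is passed to the simplex of that facet. -/
inductive Red (X : DeltaComplex.{u}) : X.SimplexSum → X.SimplexSum → Prop
  | mk {n : ℕ} (i : Fin (n + 2)) (σ : X.obj (n + 1)) (t : stdSimplex ℝ (Fin (n + 1))) :
      Red X ⟨⟨n + 1, σ⟩, stdSimplex.map i.succAbove t⟩ ⟨⟨n, X.face i σ⟩, t⟩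

theorem Red.glue {p q : X.SimplexSum} (h : X.Red p q) : X.Glue q p := by
  cases h; exact .mk _ _ _

theorem Glue.red {p q : X.SimplexSum} (h : X.Glue q p) : X.Red p q := by
  cases h; exact .mk _ _ _

theorem Red.isFacet {p q : X.SimplexSum} (h : X.Red p q) : X.IsFacet q.1 p.1 := by
  cases h; exact .mk _ _

theorem map_map_comm {n : ℕ} {i j : Fin (n + 3)} {i' j' : Fin (n + 2)}
    (h : ∀ k, i.succAbove (i'.succAbove k) = j.succAbove (j'.succAbove k))
    (t : stdSimplex ℝ (Fin (n + 1))) :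
    stdSimplex.map i.succAbove (stdSimplex.map i'.succAbove t) =
      stdSimplex.map j.succAbove (stdSimplex.map j'.succAbove t) := by
  rw [stdSimplex.map_comp_apply, stdSimplex.map_comp_apply]
  congr 1
  funext k
  exact h k

/-- If a point lies on two different facets, it lies on their intersection. -/
theorem exists_common_facet {n : ℕ} {i j : Fin (n + 2)} (hij : i ≠ j)
    {s t : stdSimplex ℝ (Fin (n + 1))}
    (h : stdSimplex.map i.succAbove s = stdSimplex.map j.succAbove t) :
    ∃ m, ∃ e : n = m + 1, ∃ i' j' : Fin (m + 2), ∃ r : stdSimplex ℝ (Fin (m + 1)),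
      s = e ▸ stdSimplex.map i'.succAbove r ∧ t = e ▸ stdSimplex.map j'.succAbove r ∧
      ∀ (X : DeltaComplex.{u}) (x : X.obj (m + 2)),
        X.face i' (X.face (e ▸ i) x) = X.face j' (X.face (e ▸ j) x) := by
  rcases n with _ | n
  · exfalso
    have h1 : ∑ k, stdSimplex.map i.succAbove s k = 0 := by
      rw [Fin.sum_univ_succAbove _ i, stdSimplex.map_succAbove_apply_self, Fin.sum_univ_one]
      have : i.succAbove 0 = j := by
        fin_cases i <;> fin_cases j <;> simp at hij ⊢
      rw [this, h, stdSimplex.map_succAbove_apply_self, add_zero]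
    rw [stdSimplex.sum_eq_one] at h1
    exact one_ne_zero h1
  · obtain ⟨i', j', h1, h2, h3, h4⟩ := exists_succAbove_comm.{u} hij
    have hs : s i' = 0 := by
      rw [← stdSimplex.map_succAbove_apply i s, h1, h, stdSimplex.map_succAbove_apply_self]
    obtain ⟨r, rfl⟩ := stdSimplex.exists_map_succAbove_eq i' hs
    refine ⟨n, rfl, i', j', r, rfl, ?_, h4⟩
    rw [map_map_comm h3] at h
    exact (stdSimplex.map_succAbove_injective j h).symm

/-- A point on two different facets lies on a common facet of both, where the two reductions meet.
This is the confluence that `mk_eq_mk_iff` needs. -/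
theorem Red.diamond {p q q' : X.SimplexSum} (h : X.Red p q) (h' : X.Red p q') :
    ∃ r, Relation.ReflGen X.Red q r ∧ Relation.ReflTransGen X.Red q' r := by
  obtain ⟨i, x, s⟩ := h
  generalize hp : (⟨⟨_ + 1, x⟩, stdSimplex.map i.succAbove s⟩ : X.SimplexSum) = p at h'
  obtain ⟨j, y, t⟩ := h'
  obtain ⟨h1, h2⟩ := Sigma.mk.inj hp
  have h3 := (Cell.mk.injEq _ _ _ _).mp h1
  obtain ⟨h4, h5⟩ := h3
  cases h4
  cases h5
  have h2 := eq_of_heq h2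
  by_cases hij : i = j
  · subst hij
    rw [stdSimplex.map_succAbove_injective i h2]
    exact ⟨_, .refl, .refl⟩
  · obtain ⟨m, rfl, i', j', r, rfl, rfl, hf⟩ := exists_common_facet hij h2
    refine ⟨_, .single (.mk _ _ _), .single ?_⟩
    have := hf X x
    dsimp only at this ⊢
    rw [this]
    exact .mk _ _ _

/-- By confluence, having a common reduct is already an equivalence relation, so it is the one
generated by the gluing. -/
theorem mk_eq_mk_iff {p q : X.SimplexSum} :
    (Quot.mk X.Glue p = Quot.mk X.Glue q) ↔ Relation.Join (Relation.ReflTransGen X.Red) p q := by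
  constructor
  · intro h
    replace h := Quot.eqvGen_exact h
    have hE := Relation.equivalence_join_reflTransGen (r := X.Red) fun a b c => Red.diamond
    induction h with
    | rel a b h => exact ⟨a, .refl, .single h.red⟩
    | refl a => exact hE.refl a
    | symm a b _ ih => exact hE.symm ih
    | trans a b c _ _ ih1 ih2 => exact hE.trans ih1 ih2
  · have key : ∀ {a b}, Relation.ReflTransGen X.Red a b → Quot.mk X.Glue a = Quot.mk X.Glue b := by
      intro a b h
      induction h with
      | refl => rfl
      | tail _ h ih => rw [ih]; exact (Quot.sound h.glue).symm
    rintro ⟨r, h1, h2⟩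
    rw [key h1, key h2]

theorem Red.mem_of_mem {A : Set X.Cell} (hA : IsLowerSet A) {p q : X.SimplexSum}
    (h : Relation.ReflTransGen X.Red p q) (hp : p.1 ∈ A) : q.1 ∈ A := by
  induction h with
  | refl => exact hp
  | tail _ h ih => exact hA (Relation.ReflTransGen.single h.isFacet) ih

theorem mem_carrier {A : Set X.Cell} {y : X.Realization} :
    y ∈ X.carrier A ↔ ∃ p : X.SimplexSum, p.1 ∈ A ∧ Quot.mk X.Glue p = y := by
  simp only [carrier, Set.mem_iUnion, Set.mem_range, charMap]
  constructor
  · rintro ⟨σ, hσ, t, rfl⟩; exact ⟨⟨σ, t⟩, hσ, rfl⟩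
  · rintro ⟨p, hp, rfl⟩; exact ⟨p.1, hp, p.2, rfl⟩

/-- A function on the points of the simplices of a subcomplex that is compatible with the face maps
is well-defined on the realization. -/
theorem eq_of_mk_eq {A : Set X.Cell} (hA : IsLowerSet A) {Z : Type*} (f : X.SimplexSum → Z)
    (hf : ∀ p q, X.Red p q → p.1 ∈ A → f p = f q) {p q : X.SimplexSum} (hp : p.1 ∈ A)
    (hq : q.1 ∈ A) (h : Quot.mk X.Glue p = Quot.mk X.Glue q) : f p = f q := by
  obtain ⟨r, h1, h2⟩ := mk_eq_mk_iff.1 h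
  have key : ∀ {a b}, Relation.ReflTransGen X.Red a b → a.1 ∈ A → f a = f b := by
    intro a b h ha
    induction h with
    | refl => rfl
    | tail h1 h2 ih => rw [ih]; exact hf _ _ h2 (Red.mem_of_mem hA h1 ha)
  rw [key h1 hp, key h2 hq]

theorem continuous_charMap (σ : X.Cell) : Continuous (X.charMap σ) :=
  continuous_quot_mk.comp continuous_sigmaMk

theorem charMap_face {n : ℕ} (i : Fin (n + 2)) (x : X.obj (n + 1))
    (t : stdSimplex ℝ (Fin (n + 1))) :
    X.charMap ⟨n, X.face i x⟩ t = X.charMap ⟨n + 1, x⟩ (stdSimplex.map i.succAbove t) :=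
  Quot.sound (.mk i x t)

/-- A point of the subcomplex on a simplex outside `A` shares a reduct with a point of a simplex in
`A`, and that reduct stays in `A`; so the point lies on a facet. The preimage is then a finite union
of compact images of preimages on the facets, and induction on the dimension applies. -/
theorem isClosed_preimage_charMap {A : Set X.Cell} (hA : IsLowerSet A) {S : Set X.Realization}
    (hS : S ⊆ X.carrier A) (h : ∀ σ ∈ A, IsClosed (X.charMap σ ⁻¹' S)) (σ : X.Cell) :
    IsClosed (X.charMap σ ⁻¹' S) := by
  obtain ⟨n, x⟩ := σ
  induction n with
  | zero =>
    by_cases hx : (⟨0, x⟩ : X.Cell) ∈ A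
    · exact h _ hx
    · convert isClosed_empty
      refine Set.eq_empty_of_forall_notMem fun t ht => ?_
      obtain ⟨q, hq, hqt⟩ := mem_carrier.1 (hS ht)
      obtain ⟨r, h1, h2⟩ := mk_eq_mk_iff.1 hqt
      have := Red.mem_of_mem hA h1 hq
      rcases Relation.ReflTransGen.cases_head h2 with rfl | ⟨c, h3, _⟩
      · exact hx this
      · nomatch h3
  | succ n ih =>
    by_cases hx : (⟨n + 1, x⟩ : X.Cell) ∈ A
    · exact h _ hx
    · have : X.charMap ⟨n + 1, x⟩ ⁻¹' S =
          ⋃ i, stdSimplex.map (Fin.succAbove i) '' (X.charMap ⟨n, X.face i x⟩ ⁻¹' S) := by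
        ext t
        simp only [Set.mem_iUnion, Set.mem_image, Set.mem_preimage]
        constructor
        · intro ht
          obtain ⟨q, hq, hqt⟩ := mem_carrier.1 (hS ht)
          obtain ⟨r, h1, h2⟩ := mk_eq_mk_iff.1 hqt
          have := Red.mem_of_mem hA h1 hq
          rcases Relation.ReflTransGen.cases_head h2 with rfl | ⟨c, h3, _⟩
          · exact absurd this hx
          · cases h3 with
            | mk i _ s =>
              refine ⟨i, s, ?_, rfl⟩
              rw [charMap_face]
              exact ht
        · rintro ⟨i, s, hs, rfl⟩
          rwa [← charMap_face]
      rw [this]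
      exact isClosed_iUnion_of_finite fun i =>
        ((ih _).isCompact.image (stdSimplex.continuous_map _)).isClosed

theorem isClosed_of_charMap {S : Set X.Realization}
    (h : ∀ σ, IsClosed (X.charMap σ ⁻¹' S)) : IsClosed S := by
  have : IsClosed (Quot.mk X.Glue ⁻¹' S) := isClosed_sigma_iff.2 h
  exact isQuotientMap_quot_mk.isClosed_preimage.1 this

/-- Continuity of a map on a subcomplex can be checked on its closed simplices. -/
theorem continuous_carrier {A : Set X.Cell} (hA : IsLowerSet A) {Z : Type*} [TopologicalSpace Z]
    (f : X.carrier A → Z)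
    (h : ∀ (σ : X.Cell) (hσ : σ ∈ A),
      Continuous fun t => f ⟨X.charMap σ t, mem_carrier.2 ⟨⟨σ, t⟩, hσ, rfl⟩⟩) :
    Continuous f := by
  rw [continuous_iff_isClosed]
  intro C hC
  refine isClosed_induced_iff.2 ⟨Subtype.val '' (f ⁻¹' C), ?_,
    Set.preimage_image_eq _ Subtype.val_injective⟩
  refine isClosed_of_charMap (isClosed_preimage_charMap hA (by rintro _ ⟨a, -, rfl⟩; exact a.2)
    fun σ hσ => ?_)
  convert hC.preimage (h σ hσ) using 1
  ext t
  constructor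
  · rintro ⟨a, ha, hat⟩
    rw [Set.mem_preimage, show a = ⟨X.charMap σ t, _⟩ from Subtype.ext hat] at ha
    exact ha
  · intro ht
    exact ⟨_, ht, rfl⟩

end DeltaComplex

/-! ### The linear collapse of a single simplex -/

namespace stdSimplex

/-- The smallest barycentric coordinate with respect to the vertices other than `i`. -/
noncomputable def minOff {n : ℕ} (i : Fin (n + 2)) (t : stdSimplex ℝ (Fin (n + 2))) : ℝ :=
  Finset.univ.inf' Finset.univ_nonempty fun k : Fin (n + 1) => t (i.succAbove k)

theorem minOff_nonneg {n : ℕ} (i : Fin (n + 2)) (t : stdSimplex ℝ (Fin (n + 2))) :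
    0 ≤ minOff i t :=
  (Finset.le_inf'_iff _ _).2 fun _ _ => zero_le _ _

theorem minOff_le {n : ℕ} (i : Fin (n + 2)) (t : stdSimplex ℝ (Fin (n + 2))) (k : Fin (n + 1)) :
    minOff i t ≤ t (i.succAbove k) :=
  Finset.inf'_le _ (Finset.mem_univ k)

theorem minOff_eq_zero {n : ℕ} {i : Fin (n + 2)} {t : stdSimplex ℝ (Fin (n + 2))}
    {j : Fin (n + 2)} (hj : j ≠ i) (h : t j = 0) : minOff i t = 0 := by
  obtain ⟨k, rfl⟩ := Fin.exists_succAbove_eq hj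
  exact le_antisymm (h ▸ minOff_le i t k) (minOff_nonneg i t)

theorem exists_minOff_eq {n : ℕ} (i : Fin (n + 2)) (t : stdSimplex ℝ (Fin (n + 2))) :
    ∃ k, t (i.succAbove k) = minOff i t := by
  obtain ⟨k, -, hk⟩ := Finset.exists_mem_eq_inf' Finset.univ_nonempty
    fun k : Fin (n + 1) => t (i.succAbove k)
  exact ⟨k, hk.symm⟩

theorem continuous_minOff {n : ℕ} (i : Fin (n + 2)) : Continuous (minOff i) :=
  Continuous.finset_inf'_apply _ fun _ _ => (continuous_apply _).comp continuous_subtype_val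

/-- The linear collapse of the standard simplex away from its `i`-th facet. -/
noncomputable def push {n : ℕ} (i : Fin (n + 2)) (t : stdSimplex ℝ (Fin (n + 2))) (c : ℝ) :
    stdSimplex ℝ (Fin (n + 2)) :=
  -- The `n + 1` other coordinates all lose the same amount, which is given to the `i`-th. Clamping
  -- the parameter to [0, 1] makes the formula valid for every real `c`.
  ⟨fun k => if k = i then t i + (n + 1) * (max 0 (min 1 c) * minOff i t)
    else t k - max 0 (min 1 c) * minOff i t, by
    have h0 : 0 ≤ max 0 (min 1 c) := le_max_left _ _
    have h1 : max 0 (min 1 c) ≤ 1 := max_le zero_le_one (min_le_left _ _)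
    have hm := minOff_nonneg i t
    constructor
    · intro k
      dsimp only
      split_ifs with hk
      · have := zero_le t i
        positivity
      · obtain ⟨k, rfl⟩ := Fin.exists_succAbove_eq hk
        have := minOff_le i t k
        nlinarith
    · rw [Fin.sum_univ_succAbove _ i]
      simp only [if_true, Fin.succAbove_ne, if_false]
      have := sum_eq_one t
      rw [Fin.sum_univ_succAbove _ i] at this
      rw [Finset.sum_sub_distrib]
      simp only [Finset.sum_const, Finset.card_univ, Fintype.card_fin, nsmul_eq_mul]
      push_cast
      linear_combination this⟩

theorem push_apply_self {n : ℕ} (i : Fin (n + 2)) (t : stdSimplex ℝ (Fin (n + 2))) (c : ℝ) :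
    push i t c i = t i + (n + 1) * (max 0 (min 1 c) * minOff i t) := if_pos rfl

theorem push_apply_of_ne {n : ℕ} {i k : Fin (n + 2)} (h : k ≠ i) (t : stdSimplex ℝ (Fin (n + 2)))
    (c : ℝ) : push i t c k = t k - max 0 (min 1 c) * minOff i t := if_neg h

theorem push_eq_self {n : ℕ} {i : Fin (n + 2)} {t : stdSimplex ℝ (Fin (n + 2))} {c : ℝ}
    (h : max 0 (min 1 c) * minOff i t = 0) : push i t c = t := by
  ext k
  by_cases hk : k = i
  · subst hk; rw [push_apply_self, h]; simp
  · rw [push_apply_of_ne hk, h, sub_zero]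

theorem push_of_nonpos {n : ℕ} (i : Fin (n + 2)) (t : stdSimplex ℝ (Fin (n + 2))) {c : ℝ}
    (hc : c ≤ 0) : push i t c = t :=
  push_eq_self (by rw [max_eq_left ((min_le_right _ _).trans hc), zero_mul])

/-- All facets other than the `i`-th stay fixed pointwise, since the minimum vanishes there. -/
theorem push_of_zero {n : ℕ} {i j : Fin (n + 2)} (hj : j ≠ i) {t : stdSimplex ℝ (Fin (n + 2))}
    (h : t j = 0) (c : ℝ) : push i t c = t :=
  push_eq_self (by rw [minOff_eq_zero hj h, mul_zero])

theorem continuous_push {n : ℕ} (i : Fin (n + 2)) :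
    Continuous fun p : stdSimplex ℝ (Fin (n + 2)) × ℝ => push i p.1 p.2 := by
  refine Continuous.subtype_mk (continuous_pi fun k => ?_) _
  have hm : Continuous fun p : stdSimplex ℝ (Fin (n + 2)) × ℝ => minOff i p.1 :=
    (continuous_minOff i).comp continuous_fst
  have ha : ∀ k, Continuous fun p : stdSimplex ℝ (Fin (n + 2)) × ℝ => p.1 k := fun k =>
    (continuous_apply k).comp (continuous_subtype_val.comp continuous_fst)
  by_cases hk : k = i
  · simp only [hk, if_true]
    have := ha i
    fun_prop
  · simp only [hk, if_false]
    have := ha k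
    fun_prop

/-- At parameter 1 the smallest coordinate off `i` has become zero. Index and point form one pair so
that `flow` can choose both together. -/
theorem exists_map_eq_push_one {n : ℕ} (i : Fin (n + 2)) (t : stdSimplex ℝ (Fin (n + 2))) :
    ∃ p : Fin (n + 1) × stdSimplex ℝ (Fin (n + 1)),
      map (i.succAbove p.1).succAbove p.2 = push i t 1 := by
  obtain ⟨k, hk⟩ := exists_minOff_eq i t
  obtain ⟨s, hs⟩ := exists_map_succAbove_eq (i.succAbove k) (s := push i t 1) (by
    rw [push_apply_of_ne (Fin.succAbove_ne i k), hk]; simp)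
  exact ⟨⟨k, s⟩, hs⟩

end stdSimplex

/-! ### Collapses of Δ-complexes as deformation retractions -/

namespace DeltaComplex

universe u

/-- The combinatorial data of a collapse of the subcomplex `A` onto the subcomplex `B`:
`Free i x` means that `x` is removed together with its free face `∂ᵢ x`. -/
structure Collapse (X : DeltaComplex.{u}) (A B : Set X.Cell) where
  lower_A : IsLowerSet A
  lower_B : IsLowerSet B
  subset : B ⊆ A
  Free : ∀ {n : ℕ}, Fin (n + 2) → X.obj (n + 1) → Prop
  rank : X.Cell → ℕ
  unique : ∀ {n : ℕ} {i j : Fin (n + 2)} {x : X.obj (n + 1)}, Free i x → Free j x → i = j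
  inj : ∀ {n : ℕ} {i j : Fin (n + 2)} {x y : X.obj (n + 1)}, Free i x → Free j y →
    X.face i x = X.face j y → x = y
  not_free_face : ∀ {n : ℕ} {i : Fin (n + 3)} {j : Fin (n + 2)} {x : X.obj (n + 2)},
    Free i x → ¬ Free j (X.face i x)
  trichotomy : ∀ σ ∈ A, σ ∈ B ∨
    (∃ (n : ℕ) (i : Fin (n + 2)) (x : X.obj (n + 1)), Free i x ∧ σ = ⟨n + 1, x⟩) ∨
    ∃ (n : ℕ) (i : Fin (n + 2)) (x : X.obj (n + 1)), Free i x ∧ σ = ⟨n, X.face i x⟩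
  mem : ∀ {n : ℕ} {i : Fin (n + 2)} {x : X.obj (n + 1)}, Free i x → ⟨n + 1, x⟩ ∈ A
  notMem : ∀ {n : ℕ} {i : Fin (n + 2)} {x : X.obj (n + 1)}, Free i x → ⟨n, X.face i x⟩ ∉ B
  rank_face : ∀ {n : ℕ} {i j : Fin (n + 2)} {x : X.obj (n + 1)}, Free i x → j ≠ i →
    rank ⟨n, X.face j x⟩ < rank ⟨n + 1, x⟩
  rank_free : ∀ {n : ℕ} {i : Fin (n + 2)} {x : X.obj (n + 1)}, Free i x →
    rank ⟨n + 1, x⟩ < rank ⟨n, X.face i x⟩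

namespace Collapse

variable {X : DeltaComplex.{u}} {A B : Set X.Cell} (C : Collapse X A B)

theorem mem_face {n : ℕ} (i : Fin (n + 2)) {x : X.obj (n + 1)} {A : Set X.Cell}
    (hA : IsLowerSet A) (hx : ⟨n + 1, x⟩ ∈ A) : ⟨n, X.face i x⟩ ∈ A :=
  hA (Relation.ReflTransGen.single (.mk i x)) hx

/-- `x` is removed as a free face. -/
def IsLow {n : ℕ} (x : X.obj n) : Prop :=
  ∃ p : Fin (n + 2) × X.obj (n + 1), C.Free p.1 p.2 ∧ X.face p.1 p.2 = x

variable {C} in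
theorem IsLow.rank_lt {n : ℕ} {x : X.obj n} (h : C.IsLow x) :
    C.rank ⟨n + 1, h.choose.2⟩ < C.rank ⟨n, x⟩ := by
  have := C.rank_free h.choose_spec.1
  rwa [h.choose_spec.2] at this

open Classical in
/-- The track of a point under the collapse: the simplices of rank `r` are collapsed during the time
interval `[2⁻ʳ, 2¹⁻ʳ]`. -/
noncomputable def flow :
    (n : ℕ) → (x : X.obj n) → stdSimplex ℝ (Fin (n + 1)) → ℝ → X.Realization
  | 0, x, t, u =>
    if h : C.IsLow x then flow 1 h.choose.2 (stdSimplex.map h.choose.1.succAbove t) u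
    else X.charMap ⟨0, x⟩ t
  | n + 1, x, t, u =>
    if h : C.IsLow x then flow (n + 2) h.choose.2 (stdSimplex.map h.choose.1.succAbove t) u
    else if h : ∃ i, C.Free i x then
      -- The parameter below runs from 0 to 1 as `u` runs from 2⁻ʳ to 2¹⁻ʳ; earlier it is negative
      -- and `push` is the identity.
      if u ≤ 2 * (1 / 2) ^ C.rank ⟨n + 1, x⟩ then
        X.charMap ⟨n + 1, x⟩ (stdSimplex.push h.choose t (2 ^ C.rank ⟨n + 1, x⟩ * u - 1))
      else
        flow n (X.face (h.choose.succAbove (stdSimplex.exists_map_eq_push_one h.choose t).choose.1) x)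
          (stdSimplex.exists_map_eq_push_one h.choose t).choose.2 u
    else X.charMap ⟨n + 1, x⟩ t
termination_by n x => C.rank ⟨n, x⟩
decreasing_by
  · exact h.rank_lt
  · exact IsLow.rank_lt ‹_›
  · exact C.rank_face h.choose_spec (Fin.succAbove_ne _ _)

theorem flow_low {n : ℕ} {i : Fin (n + 2)} {x : X.obj (n + 1)} (h : C.Free i x)
    (t : stdSimplex ℝ (Fin (n + 1))) (u : ℝ) :
    C.flow n (X.face i x) t u = C.flow (n + 1) x (stdSimplex.map i.succAbove t) u := by
  have hl : C.IsLow (X.face i x) := ⟨(i, x), h, rfl⟩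
  have key : hl.choose = (i, x) := by
    have h2 := C.inj hl.choose_spec.1 h hl.choose_spec.2
    have h1 := hl.choose_spec.1
    rw [h2] at h1
    exact Prod.ext (C.unique h1 h) h2
  cases n with
  | zero => rw [flow, dif_pos hl, key]
  | succ n => rw [flow, dif_pos hl, key]

theorem flow_of_mem {n : ℕ} {x : X.obj n} (hx : ⟨n, x⟩ ∈ B) (t : stdSimplex ℝ (Fin (n + 1)))
    (u : ℝ) : C.flow n x t u = X.charMap ⟨n, x⟩ t := by
  have hl : ¬ C.IsLow x := by
    rintro ⟨p, h, rfl⟩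
    exact C.notMem h hx
  cases n with
  | zero => rw [flow, dif_neg hl]
  | succ n =>
    rw [flow, dif_neg hl, dif_neg]
    rintro ⟨i, h⟩
    exact C.notMem h (mem_face i C.lower_B hx)

theorem not_isLow_of_free {n : ℕ} {i : Fin (n + 2)} {x : X.obj (n + 1)} (h : C.Free i x) :
    ¬ C.IsLow x := by
  rintro ⟨p, hp, rfl⟩
  exact C.not_free_face hp h

theorem flow_early {n : ℕ} {i : Fin (n + 2)} {x : X.obj (n + 1)} (h : C.Free i x)
    (t : stdSimplex ℝ (Fin (n + 2))) {u : ℝ} (hu : u ≤ 2 * (1 / 2) ^ C.rank ⟨n + 1, x⟩) :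
    C.flow (n + 1) x t u =
      X.charMap ⟨n + 1, x⟩ (stdSimplex.push i t (2 ^ C.rank ⟨n + 1, x⟩ * u - 1)) := by
  have hi : ∃ i, C.Free i x := ⟨i, h⟩
  rw [flow, dif_neg (C.not_isLow_of_free h), dif_pos hi, if_pos hu, C.unique hi.choose_spec h]

theorem exists_flow_late {n : ℕ} {i : Fin (n + 2)} {x : X.obj (n + 1)} (h : C.Free i x)
    (t : stdSimplex ℝ (Fin (n + 2))) {u : ℝ} (hu : 2 * (1 / 2) ^ C.rank ⟨n + 1, x⟩ < u) :
    ∃ j ≠ i, ∃ s, stdSimplex.map j.succAbove s = stdSimplex.push i t 1 ∧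
      C.flow (n + 1) x t u = C.flow n (X.face j x) s u := by
  have hi : ∃ i, C.Free i x := ⟨i, h⟩
  obtain rfl := C.unique hi.choose_spec h
  refine ⟨_, Fin.succAbove_ne _ _, _,
    (stdSimplex.exists_map_eq_push_one hi.choose t).choose_spec, ?_⟩
  rw [flow, dif_neg (C.not_isLow_of_free h), dif_pos hi, if_neg hu.not_ge]

/-- No cell moves before time 2⁻ʳ, where r is its rank. A free face has larger rank than its coface,
so the coface, whose track it follows, is still at rest too. -/
theorem flow_eq_charMap {n : ℕ} {x : X.obj n} (hx : ⟨n, x⟩ ∈ A) (t : stdSimplex ℝ (Fin (n + 1)))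
    {u : ℝ} (hu : u ≤ (1 / 2) ^ C.rank ⟨n, x⟩) : C.flow n x t u = X.charMap ⟨n, x⟩ t := by
  have high : ∀ {n : ℕ} {i : Fin (n + 2)} {x : X.obj (n + 1)}, C.Free i x →
      ∀ (t : stdSimplex ℝ (Fin (n + 2))), u ≤ (1 / 2) ^ C.rank ⟨n + 1, x⟩ →
      C.flow (n + 1) x t u = X.charMap ⟨n + 1, x⟩ t := by
    intro n i x h t hu
    have hp : (0 : ℝ) < (1 / 2) ^ C.rank ⟨n + 1, x⟩ := by positivity
    rw [C.flow_early h t (by linarith), stdSimplex.push_of_nonpos]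
    have : (2 : ℝ) ^ C.rank ⟨n + 1, x⟩ * u ≤
      2 ^ C.rank ⟨n + 1, x⟩ * (1 / 2) ^ C.rank ⟨n + 1, x⟩ := by gcongr
    rw [← mul_pow] at this
    norm_num at this
    linarith
  rcases C.trichotomy _ hx with h | ⟨m, i, y, h, he⟩ | ⟨m, i, y, h, he⟩
  · exact C.flow_of_mem h t u
  · cases he
    exact high h t hu
  · cases he
    rw [C.flow_low h, high h, charMap_face]
    exact hu.trans (pow_le_pow_of_le_one (by norm_num) (by norm_num) (C.rank_free h).le)

/-- Facets other than the free one have smaller rank, so they start to move only after the simplex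
has finished collapsing. -/
theorem two_mul_pow_le {n : ℕ} {i j : Fin (n + 2)} {x : X.obj (n + 1)} (h : C.Free i x)
    (hj : j ≠ i) : 2 * (1 / 2 : ℝ) ^ C.rank ⟨n + 1, x⟩ ≤ (1 / 2) ^ C.rank ⟨n, X.face j x⟩ := by
  have := C.rank_face h hj
  calc 2 * (1 / 2 : ℝ) ^ C.rank ⟨n + 1, x⟩
      ≤ 2 * (1 / 2 : ℝ) ^ (C.rank ⟨n, X.face j x⟩ + 1) := by
        gcongr ?_ * ?_
        exact pow_le_pow_of_le_one (by norm_num) (by norm_num) this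
    _ = _ := by rw [pow_succ]; ring

/-- For a point on two facets, both facets give the same track. -/
theorem flow_face_eq {n : ℕ} {x : X.obj (n + 1)} {i j : Fin (n + 2)} {u : ℝ}
    (hi : ∀ {m : ℕ} {y : X.obj (m + 1)} (k : Fin (m + 2)) (r : stdSimplex ℝ (Fin (m + 1))),
      (⟨n, X.face i x⟩ : X.Cell) = ⟨m + 1, y⟩ →
      C.flow m (X.face k y) r u = C.flow (m + 1) y (stdSimplex.map k.succAbove r) u)
    (hj : ∀ {m : ℕ} {y : X.obj (m + 1)} (k : Fin (m + 2)) (r : stdSimplex ℝ (Fin (m + 1))),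
      (⟨n, X.face j x⟩ : X.Cell) = ⟨m + 1, y⟩ →
      C.flow m (X.face k y) r u = C.flow (m + 1) y (stdSimplex.map k.succAbove r) u)
    {s t : stdSimplex ℝ (Fin (n + 1))}
    (h : stdSimplex.map i.succAbove s = stdSimplex.map j.succAbove t) :
    C.flow n (X.face i x) s u = C.flow n (X.face j x) t u := by
  by_cases hij : i = j
  · subst hij
    rw [stdSimplex.map_succAbove_injective i h]
  · obtain ⟨m, rfl, i', j', r, rfl, rfl, hf⟩ := exists_common_facet hij h
    have := hf X x
    dsimp only at this ⊢
    rw [← hi i' r rfl, ← hj j' r rfl, this]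

/-- This lets the flow descend to the realization. Points on a facet other than the free one are not
pushed: early on that facet is still at rest, and later the point is handed to some facet containing
it, which the induction on the rank compares with the given one. A free face borrows the track of
its coface, where the two facets involved can be exchanged. -/
theorem flow_face (u : ℝ) (N : ℕ) : ∀ {n : ℕ} {x : X.obj (n + 1)}, ⟨n + 1, x⟩ ∈ A →
    C.rank ⟨n + 1, x⟩ < N → ∀ (i : Fin (n + 2)) (t : stdSimplex ℝ (Fin (n + 1))),
    C.flow n (X.face i x) t u = C.flow (n + 1) x (stdSimplex.map i.succAbove t) u := by
  induction N with
  | zero => intro n x _ h; omega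
  | succ N ih =>
    intro n x hx hN i t
    rcases C.trichotomy _ hx with h | ⟨m, i₀, y, h, he⟩ | ⟨m, i₀, y, h, he⟩
    · rw [C.flow_of_mem h, C.flow_of_mem (mem_face i C.lower_B h), charMap_face]
    · cases he
      by_cases hi : i = i₀
      · subst hi; exact C.flow_low h t u
      have hfix : ∀ c, stdSimplex.push i₀ (stdSimplex.map i.succAbove t) c =
          stdSimplex.map i.succAbove t :=
        stdSimplex.push_of_zero hi (stdSimplex.map_succAbove_apply_self i t)
      rcases le_or_gt u (2 * (1 / 2) ^ C.rank ⟨n + 1, x⟩) with hu | hu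
      · rw [C.flow_early h _ hu, hfix, ← charMap_face]
        exact C.flow_eq_charMap (mem_face i C.lower_A hx) _ (hu.trans (C.two_mul_pow_le h hi))
      · obtain ⟨j, hj, s, hs, he⟩ := C.exists_flow_late h (stdSimplex.map i.succAbove t) hu
        rw [he]
        rw [hfix] at hs
        have hri := C.rank_face h hi
        have hrj := C.rank_face h hj
        refine C.flow_face_eq (fun {m y} k r e => ?_) (fun {m y} k r e => ?_) hs.symm
        · rw [e] at hri
          exact ih (e ▸ mem_face i C.lower_A hx) (by omega) k r
        · rw [e] at hrj
          exact ih (e ▸ mem_face j C.lower_A hx) (by omega) k r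
    · cases he
      have hr := C.rank_free h
      have hne : i₀ ≠ i₀.succAbove i := (Fin.succAbove_ne _ _).symm
      obtain ⟨i', j', h1, h2, h3, h4⟩ := exists_succAbove_comm.{u} hne
      obtain rfl := Fin.succAbove_right_injective h1
      have hrj := C.rank_face h hne.symm
      rw [C.flow_low h, map_map_comm h3, h4 X y, ih (mem_face _ C.lower_A (C.mem h)) (by omega),
        ih (C.mem h) (by omega)]

/-- The track does not depend on which facet containing the pushed point `flow` selects, and at the
switching time both formulas give the pushed point. -/
theorem flow_late {n : ℕ} {i j : Fin (n + 2)} {x : X.obj (n + 1)} (h : C.Free i x)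
    (hj : j ≠ i) (t : stdSimplex ℝ (Fin (n + 2))) {s : stdSimplex ℝ (Fin (n + 1))}
    (hs : stdSimplex.map j.succAbove s = stdSimplex.push i t 1) {u : ℝ}
    (hu : 2 * (1 / 2) ^ C.rank ⟨n + 1, x⟩ ≤ u) :
    C.flow (n + 1) x t u = C.flow n (X.face j x) s u := by
  rcases hu.eq_or_lt with rfl | hu
  · rw [C.flow_early h t le_rfl, C.flow_eq_charMap (mem_face j C.lower_A (C.mem h)) s
      (C.two_mul_pow_le h hj), charMap_face, hs]
    congr 2
    have : (2 : ℝ) ^ C.rank ⟨n + 1, x⟩ * (1 / 2) ^ C.rank ⟨n + 1, x⟩ = 1 := by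
      rw [← mul_pow]; norm_num
    linear_combination 2 * this
  · obtain ⟨k, hk, r, hr, he⟩ := C.exists_flow_late h t hu
    rw [he]
    refine C.flow_face_eq (fun {m y} l q e => ?_) (fun {m y} l q e => ?_) (hr.trans hs.symm)
    · exact C.flow_face u _ (e ▸ mem_face k C.lower_A (C.mem h)) (Nat.lt_succ_self _) l q
    · exact C.flow_face u _ (e ▸ mem_face j C.lower_A (C.mem h)) (Nat.lt_succ_self _) l q

theorem continuous_flow (N : ℕ) : ∀ {n : ℕ} {x : X.obj n}, ⟨n, x⟩ ∈ A → C.rank ⟨n, x⟩ < N →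
    Continuous fun p : stdSimplex ℝ (Fin (n + 1)) × ℝ => C.flow n x p.1 p.2 := by
  induction N with
  | zero => intro n x _ h; omega
  | succ N ih =>
    intro n x hx hN
    rcases C.trichotomy _ hx with h | ⟨m, i, y, h, he⟩ | ⟨m, i, y, h, he⟩
    · simp only [C.flow_of_mem h]
      exact (continuous_charMap _).comp continuous_fst
    · cases he
      set U : ℝ := 2 * (1 / 2) ^ C.rank ⟨m + 1, y⟩ with hU
      have hpush : Continuous fun p : stdSimplex ℝ (Fin (m + 2)) × ℝ => stdSimplex.push i p.1 1 :=
        (stdSimplex.continuous_push i).comp (continuous_fst.prodMk continuous_const)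
      -- `none` is the early phase and `some k` the late phase with the pushed point on the facet
      -- `i.succAbove k`: finitely many closed sets, with one continuous formula on each.
      let S : Option (Fin (m + 1)) → Set (stdSimplex ℝ (Fin (m + 2)) × ℝ) := fun o =>
        o.elim {p | p.2 ≤ U}
          fun k => {p | U ≤ p.2 ∧ stdSimplex.push i p.1 1 (i.succAbove k) = 0}
      refine (locallyFinite_of_finite S).continuous ?_ ?_ ?_
      · refine Set.eq_univ_of_forall fun p => Set.mem_iUnion.2 ?_
        rcases le_total p.2 U with hu | hu
        · exact ⟨none, hu⟩
        · obtain ⟨⟨k, s⟩, hs⟩ := stdSimplex.exists_map_eq_push_one i p.1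
          exact ⟨some k, hu, by rw [← hs, stdSimplex.map_succAbove_apply_self]⟩
      · rintro (_ | k)
        · exact isClosed_le continuous_snd continuous_const
        · exact (isClosed_le continuous_const continuous_snd).inter (isClosed_eq
            ((continuous_apply _).comp (continuous_subtype_val.comp hpush)) continuous_const)
      · rintro (_ | k)
        · refine ContinuousOn.congr (f := fun p => X.charMap ⟨m + 1, y⟩
            (stdSimplex.push i p.1 (2 ^ C.rank ⟨m + 1, y⟩ * p.2 - 1))) ?_
            fun p hp => C.flow_early h p.1 hp
          have ht : Continuous fun p : stdSimplex ℝ (Fin (m + 2)) × ℝ =>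
              (2 : ℝ) ^ C.rank ⟨m + 1, y⟩ * p.2 - 1 := by fun_prop
          exact ((continuous_charMap _).comp ((stdSimplex.continuous_push i).comp
            (continuous_fst.prodMk ht))).continuousOn
        · have hk := Fin.succAbove_ne i k
          have hr := C.rank_face h hk
          -- `invFun` gives a map defined and continuous on the whole simplex that inverts the facet
          -- inclusion on the facet.
          refine ContinuousOn.congr (f := fun p => C.flow m (X.face (i.succAbove k) y)
            (stdSimplex.map (Function.invFun (i.succAbove k).succAbove)
              (stdSimplex.push i p.1 1)) p.2) ?_ ?_
          · exact ((ih (mem_face _ C.lower_A hx) (by omega)).comp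
              (((stdSimplex.continuous_map _).comp hpush).prodMk continuous_snd)).continuousOn
          · rintro p ⟨hu, hp⟩
            obtain ⟨s, hs⟩ := stdSimplex.exists_map_succAbove_eq _ hp
            dsimp only
            rw [← hs, stdSimplex.map_invFun_succAbove]
            exact C.flow_late h hk p.1 hs hu
    · cases he
      have hr := C.rank_free h
      simp only [C.flow_low h]
      exact (ih (C.mem h) (by omega)).comp
        (((stdSimplex.continuous_map _).comp continuous_fst).prodMk continuous_snd)

theorem flow_mem_A (u : ℝ) (N : ℕ) : ∀ {n : ℕ} {x : X.obj n}, ⟨n, x⟩ ∈ A → C.rank ⟨n, x⟩ < N →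
    ∀ t, C.flow n x t u ∈ X.carrier A := by
  induction N with
  | zero => intro n x _ h; omega
  | succ N ih =>
    intro n x hx hN t
    rcases C.trichotomy _ hx with h | ⟨m, i, y, h, he⟩ | ⟨m, i, y, h, he⟩
    · rw [C.flow_of_mem h]
      exact mem_carrier.2 ⟨⟨_, t⟩, hx, rfl⟩
    · cases he
      rcases le_or_gt u (2 * (1 / 2) ^ C.rank ⟨m + 1, y⟩) with hu | hu
      · rw [C.flow_early h _ hu]
        exact mem_carrier.2 ⟨⟨_, _⟩, hx, rfl⟩
      · obtain ⟨j, hj, s, hs, he⟩ := C.exists_flow_late h t hu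
        have hr := C.rank_face h hj
        rw [he]
        exact ih (mem_face j C.lower_A hx) (by omega) s
    · cases he
      have hr := C.rank_free h
      rw [C.flow_low h]
      exact ih (C.mem h) (by omega) _

theorem flow_one_mem_B (N : ℕ) : ∀ {n : ℕ} {x : X.obj n}, ⟨n, x⟩ ∈ A → C.rank ⟨n, x⟩ < N →
    ∀ t, C.flow n x t 1 ∈ X.carrier B := by
  induction N with
  | zero => intro n x _ h; omega
  | succ N ih =>
    intro n x hx hN t
    rcases C.trichotomy _ hx with h | ⟨m, i, y, h, he⟩ | ⟨m, i, y, h, he⟩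
    · rw [C.flow_of_mem h]
      exact mem_carrier.2 ⟨⟨_, t⟩, h, rfl⟩
    · cases he
      obtain ⟨⟨k, s⟩, hs⟩ := stdSimplex.exists_map_eq_push_one i t
      have hr := C.rank_face h (Fin.succAbove_ne i k)
      rw [C.flow_late h (Fin.succAbove_ne i k) t hs]
      · exact ih (mem_face _ C.lower_A hx) (by omega) s
      · exact (C.two_mul_pow_le h (Fin.succAbove_ne i k)).trans
          (pow_le_one₀ (by norm_num) (by norm_num))
    · cases he
      have hr := C.rank_free h
      rw [C.flow_low h]
      exact ih (C.mem h) (by omega) _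

/-- The flow, as a function of the points of the simplices. -/
noncomputable def track (p : X.SimplexSum) (u : ℝ) : X.Realization :=
  C.flow p.1.dim p.1.simplex p.2 u

theorem track_eq {p q : X.SimplexSum} (hp : p.1 ∈ A) (hq : q.1 ∈ A)
    (h : Quot.mk X.Glue p = Quot.mk X.Glue q) (u : ℝ) : C.track p u = C.track q u := by
  refine eq_of_mk_eq C.lower_A (fun p => C.track p u) ?_ hp hq h
  rintro _ _ ⟨i, x, t⟩ hx
  exact (C.flow_face u _ hx (Nat.lt_succ_self _) i t).symm

/-- A subcomplex deformation retracts onto every subcomplex onto which it collapses. -/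
theorem deformationRetractsOnto (C : Collapse X A B) :
    DeformationRetractsOnto (X.carrier A) (X.carrier B) := by
  refine ⟨fun y hy => ?_, ?_⟩
  · obtain ⟨p, hp, rfl⟩ := mem_carrier.1 hy
    exact mem_carrier.2 ⟨p, C.subset hp, rfl⟩
  choose rep hrepA hrep using fun y : X.carrier A => mem_carrier.1 y.2
  have hmem : ∀ y u, C.track (rep y) u ∈ X.carrier A := fun y u =>
    C.flow_mem_A u _ (hrepA y) (Nat.lt_succ_self _) _
  have hcont : Continuous fun p : X.carrier A × unitInterval =>
      (⟨C.track (rep p.1) p.2, hmem _ _⟩ : X.carrier A) := by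
    have hc : ∀ y, Continuous fun u : unitInterval =>
        (⟨C.track (rep y) u, hmem _ _⟩ : X.carrier A) := fun y =>
      ((C.continuous_flow _ (hrepA y) (Nat.lt_succ_self _)).comp
        (continuous_const.prodMk continuous_subtype_val)).subtype_mk _
    -- Continuity can be tested on closed simplices for maps out of the subcomplex, but not directly
    -- for maps out of its product with the interval. So the homotopy is curried, and uncurried at
    -- the end by local compactness of the interval.
    let F : X.carrier A → C(unitInterval, X.carrier A) := fun y => ⟨_, hc y⟩
    have hF : Continuous F := by
      refine continuous_carrier C.lower_A F fun σ hσ => ?_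
      refine ContinuousMap.continuous_of_continuous_uncurry _ ?_
      refine Continuous.subtype_mk (p := (· ∈ X.carrier A))
        (f := fun p : stdSimplex ℝ (Fin (σ.dim + 1)) × unitInterval =>
          C.track (rep ⟨X.charMap σ p.1, mem_carrier.2 ⟨⟨σ, p.1⟩, hσ, rfl⟩⟩) p.2) ?_ _
      have : ∀ p : stdSimplex ℝ (Fin (σ.dim + 1)) × unitInterval,
          C.track (rep ⟨X.charMap σ p.1, mem_carrier.2 ⟨⟨σ, p.1⟩, hσ, rfl⟩⟩) p.2 =
            C.flow σ.dim σ.simplex p.1 p.2 := fun p =>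
        C.track_eq (q := ⟨σ, p.1⟩) (hrepA _) hσ (hrep _) _
      simp only [this]
      exact (C.continuous_flow _ hσ (Nat.lt_succ_self _)).comp
        (continuous_fst.prodMk (continuous_subtype_val.comp continuous_snd))
    exact ContinuousMap.continuous_uncurry_of_continuous ⟨F, hF⟩
  have h0 : ∀ y, C.track (rep y) 0 = y := fun y =>
    (C.flow_eq_charMap (hrepA y) _ (by positivity)).trans (hrep y)
  have hB : ∀ y : X.carrier A, (y : X.Realization) ∈ X.carrier B → ∀ u,
      C.track (rep y) u = y := by
    intro y hy u
    obtain ⟨p, hp, hpy⟩ := mem_carrier.1 hy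
    rw [C.track_eq (hrepA y) (C.subset hp) ((hrep y).trans hpy.symm), ← hpy]
    exact C.flow_of_mem hp _ _
  refine ⟨⟨fun y => ⟨C.track (rep y) 1, hmem _ _⟩, ?_⟩, fun y =>
    C.flow_one_mem_B _ (hrepA y) (Nat.lt_succ_self _) _, ⟨?_⟩⟩
  · exact hcont.comp (continuous_id.prodMk (continuous_const (y := (1 : unitInterval))))
  · exact
      { toFun := fun p => ⟨C.track (rep p.2) p.1, hmem _ _⟩
        continuous_toFun := hcont.comp (continuous_snd.prodMk continuous_fst)
        map_zero_left := fun y => Subtype.ext (h0 y)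
        map_one_left := fun y => rfl
        prop' := fun u y hy => Subtype.ext (hB y hy u) }

end Collapse
end DeltaComplex

/-! ### Reachability in acyclic and proper matchings -/

namespace PosetMatching

variable {P : Type*} [PartialOrder P] {M : Set (P × P)}

theorem eq_of_mem_of_mem (hM : IsMatching M) {e f : P × P} (he : e ∈ M) (hf : f ∈ M) {p : P}
    (hpe : p = e.1 ∨ p = e.2) (hpf : p = f.1 ∨ p = f.2) : e = f := by
  by_contra h
  have hpe' : p ∈ ({e.1, e.2} : Set P) := hpe
  exact Set.disjoint_left.1 (hM.2 e he f hf h) hpe' hpf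

/-- The number of elements that can be reached decreases along the arrows. -/
theorem ncard_reachable_lt (hac : IsAcyclic M) (hpr : IsProper M) {p q : P} (h : Arrow M p q) :
    {r | Relation.ReflTransGen (Arrow M) q r}.ncard <
      {r | Relation.ReflTransGen (Arrow M) p r}.ncard := by
  refine Set.ncard_lt_ncard ?_ (hpr p)
  rw [Set.ssubset_iff_of_subset]
  · exact ⟨p, .refl, fun hq => hac p (Relation.TransGen.head' h hq)⟩
  · exact fun r hr => Relation.ReflTransGen.head h hr

/-- Arrows that decrease a well-founded relation form no cycles. -/
theorem isAcyclic_of_wellFounded {r : P → P → Prop} (hr : WellFounded r)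
    (h : ∀ p q, Arrow M p q → r q p) : IsAcyclic M := by
  have hwf : WellFounded fun q p => Arrow M p q := Subrelation.wf (h _ _) hr
  intro p hp
  have := hwf.transGen.irrefl.irrefl p
  rw [Relation.transGen_swap] at this
  exact this hp

/-- Well-founded induction: what is reachable from `p` is `p` together with a finite union of finite
sets. -/
theorem isProper_of_wellFounded {r : P → P → Prop} (hr : WellFounded r)
    (h : ∀ p q, Arrow M p q → r q p) (hfin : ∀ p, {q | Arrow M p q}.Finite) : IsProper M := by
  intro p
  induction p using hr.induction with
  | _ p ih =>
    refine ((Set.finite_singleton p).union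
      ((hfin p).biUnion (t := fun q => {r | Relation.ReflTransGen (Arrow M) q r})
        fun q hq => ih q (h _ _ hq))).subset ?_
    intro q hq
    rcases Relation.ReflTransGen.cases_head hq with rfl | ⟨c, hc, hcq⟩
    · exact Or.inl rfl
    · exact Or.inr (Set.mem_biUnion (show c ∈ {q | Arrow M p q} from hc) hcq)

end PosetMatching

/-! ### From matchings to collapses -/

namespace DeltaComplex

universe u

variable {X : DeltaComplex.{u}} {A B : Set X.Cell}

theorem IsFacet.lt {σ τ : X.Cell} (h : X.IsFacet σ τ) : σ < τ := by
  refine lt_of_le_of_ne (Relation.ReflTransGen.single h) ?_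
  rintro rfl
  have := h.dim_eq
  omega

theorem dim_lt_of_lt {σ τ : X.Cell} (h : σ < τ) : σ.dim < τ.dim :=
  (eq_or_dim_lt h.le).resolve_left h.ne

theorem cell_covBy_iff {σ τ : X.Cell} : σ ⋖ τ ↔ X.IsFacet σ τ := by
  constructor
  · intro h
    rcases Relation.ReflTransGen.cases_tail (show Relation.ReflTransGen X.IsFacet σ τ from h.le)
      with he | ⟨c, hpc, hcq⟩
    · exact absurd he h.ne'
    · rcases (show σ ≤ c from hpc).eq_or_lt with he | hlt
      · rwa [he]
      · exact absurd hcq.lt (h.2 hlt)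
  · intro h
    refine ⟨h.lt, fun c hpc hcq => ?_⟩
    have h1 := dim_lt_of_lt hpc
    have h2 := dim_lt_of_lt hcq
    have := h.dim_eq
    omega

theorem covBy_iff_isFacet (hA : IsLowerSet A) {p q : A} : p ⋖ q ↔ X.IsFacet p q := by
  rw [← cell_covBy_iff]
  refine (Set.OrdConnected.apply_covBy_apply_iff (OrderEmbedding.subtype (· ∈ A)) ?_).symm
  rw [OrderEmbedding.coe_subtype, Subtype.range_val]
  exact hA.ordConnected

theorem IsFacet.exists_face {n : ℕ} {τ : X.Cell} {x : X.obj (n + 1)}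
    (h : X.IsFacet τ ⟨n + 1, x⟩) : ∃ i, τ = ⟨n, X.face i x⟩ := by
  cases h with
  | mk i => exact ⟨i, rfl⟩

theorem finite_isFacet (σ : X.Cell) : {τ | X.IsFacet τ σ}.Finite := by
  obtain ⟨n, x⟩ := σ
  cases n with
  | zero =>
    convert Set.finite_empty
    refine Set.eq_empty_of_forall_notMem fun τ h => ?_
    have := IsFacet.dim_eq h
    simp at this
  | succ n =>
    refine (Set.finite_range fun i => (⟨n, X.face i x⟩ : X.Cell)).subset ?_
    intro τ h
    obtain ⟨i, rfl⟩ := IsFacet.exists_face h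
    exact ⟨i, rfl⟩

open PosetMatching

open Classical in
/-- An acyclic, proper matching with regular edges, all of whose critical cells lie in a
subcomplex, is a collapse onto this subcomplex. -/
noncomputable def Collapse.ofMatching (hA : IsLowerSet A) (hB : IsLowerSet B) (hBA : B ⊆ A)
    {M : Set (A × A)} (hM : IsMatching M) (hreg : ∀ e ∈ M, X.IsRegularFace e.1 e.2)
    (hac : IsAcyclic M) (hpr : IsProper M) (hcr : ∀ σ : A, IsCritical M σ ↔ (σ : X.Cell) ∈ B) :
    Collapse X A B :=
  -- By regularity a matched facet occurs under one index only, so the facets with other indices are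
  -- other cells and their edges point downwards.
  have hfree : ∀ {n : ℕ} {i j : Fin (n + 2)} {x : X.obj (n + 1)} {h1 : ⟨n + 1, x⟩ ∈ A}
      {h0 : ⟨n, X.face i x⟩ ∈ A}, ((⟨_, h0⟩, ⟨_, h1⟩) : A × A) ∈ M →
      X.face i x = X.face j x → i = j := by
    intro n i j x h1 h0 hm he
    obtain ⟨m, x', y', e1, e2, hu⟩ := hreg _ hm
    cases e1
    cases e2
    exact hu.unique rfl he.symm
  { lower_A := hA
    lower_B := hB
    subset := hBA
    Free := fun {n} i x => ∃ (h0 : ⟨n, X.face i x⟩ ∈ A) (h1 : ⟨n + 1, x⟩ ∈ A),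
      ((⟨_, h0⟩, ⟨_, h1⟩) : A × A) ∈ M
    -- The default value outside `A` plays no role, since free pairs and all facets involved lie in
    -- the lower set `A`.
    rank := fun σ =>
      if h : σ ∈ A then {q | Relation.ReflTransGen (Arrow M) ⟨σ, h⟩ q}.ncard else 0
    unique := by
      rintro n i j x ⟨h0, h1, hm⟩ ⟨h0', h1', hm'⟩
      have := eq_of_mem_of_mem hM hm hm' (Or.inr rfl) (Or.inr rfl)
      refine hfree hm ?_
      simpa using congrArg (fun e : A × A => e.1.1) this
    inj := by
      rintro n i j x y ⟨h0, h1, hm⟩ ⟨h0', h1', hm'⟩ he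
      have := eq_of_mem_of_mem hM hm hm' (p := ⟨_, h0⟩) (Or.inl rfl) (Or.inl (by simp only [he]))
      simpa using congrArg (fun e : A × A => e.2.1) this
    not_free_face := by
      rintro n i j x ⟨h0, h1, hm⟩ ⟨h0', h1', hm'⟩
      have := eq_of_mem_of_mem hM hm hm' (Or.inl rfl) (Or.inr rfl)
      have := congrArg (fun e : A × A => e.2.1.dim) this
      simp at this
    trichotomy := by
      intro σ hσ
      by_cases hc : IsCritical M ⟨σ, hσ⟩
      · exact Or.inl ((hcr _).1 hc)
      refine Or.inr ?_
      simp only [IsCritical, not_forall, not_and_or, not_not] at hc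
      obtain ⟨⟨⟨τ, hτ⟩, ⟨ρ, hρ⟩⟩, he, hc⟩ := hc
      obtain ⟨i, x⟩ := (covBy_iff_isFacet hA).1 (hM.1 _ he)
      rcases hc with hc | hc
      · exact Or.inr ⟨_, i, x, ⟨_, _, he⟩, congrArg Subtype.val hc⟩
      · exact Or.inl ⟨_, i, x, ⟨_, _, he⟩, congrArg Subtype.val hc⟩
    mem := by
      rintro n i x ⟨h0, h1, -⟩
      exact h1
    notMem := by
      rintro n i x ⟨h0, h1, hm⟩ hB
      exact ((hcr ⟨_, h0⟩).2 hB _ hm).1 rfl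
    rank_face := by
      rintro n i j x ⟨h0, h1, hm⟩ hj
      have h2 : ⟨n, X.face j x⟩ ∈ A := hA (Relation.ReflTransGen.single (.mk j x)) h1
      rw [dif_pos h2, dif_pos h1]
      refine ncard_reachable_lt hac hpr (Or.inr ⟨(covBy_iff_isFacet hA).2 (.mk j x), fun hm' => ?_⟩)
      have := eq_of_mem_of_mem hM hm hm' (Or.inr rfl) (Or.inr rfl)
      exact hj (hfree hm (by simpa using congrArg (fun e : A × A => e.1.1) this)).symm
    rank_free := by
      rintro n i x ⟨h0, h1, hm⟩
      rw [dif_pos h0, dif_pos h1]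
      exact ncard_reachable_lt hac hpr (Or.inl hm) }

end DeltaComplex

/-! ### The geometric representation -/

namespace CoxeterMatrix

variable {n : ℕ} (M : CoxeterMatrix (Fin n))

open Module Real

/-- The linear form `v ↦ 2 B(αᵢ, v)` of the geometric representation. -/
noncomputable def coroot (i : Fin n) : Dual ℝ (Fin n → ℝ) :=
  ∑ j, (-2 * cos (π / M i j)) • LinearMap.proj j

theorem coroot_single (i j : Fin n) : M.coroot i (Pi.single j 1) = -2 * cos (π / M i j) := by
  simp [coroot, LinearMap.sum_apply, Pi.single_apply]

theorem coroot_single_self (i : Fin n) : M.coroot i (Pi.single i 1) = 2 := by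
  simp [coroot_single]

theorem S_eval_eq_zero_of_sin {θ : ℝ} (hθ : sin θ ≠ 0) {k : ℤ} (h : sin ((k + 1) * θ) = 0) :
    (Polynomial.Chebyshev.S ℝ k).eval (2 * cos θ) = 0 := by
  have := Polynomial.Chebyshev.S_two_mul_real_cos θ k
  rw [h] at this
  exact (mul_eq_zero.1 this).resolve_right hθ

/-- Powers of a product of two reflections have Chebyshev coefficients in 2 cos θ with θ = 2π/m, and
S_k(2 cos θ) sin θ = sin((k+1)θ). For m = 2k they vanish because sin kθ = sin π; for m = 2k+1
because the angles kθ and (k+1)θ add up to 2π. For m = 2 one cannot divide by sin θ = 0, so this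
case is computed directly. -/
theorem reflection_mul_reflection_pow_eq_one (i j : Fin n) :
    (reflection (M.coroot_single_self i) * reflection (M.coroot_single_self j)) ^ M i j = 1 := by
  rcases eq_or_ne i j with rfl | hij
  · rw [M.diagonal, pow_one]
    ext1 v
    exact involutive_reflection (M.coroot_single_self i) v
  have hm1 : M i j ≠ 1 := M.off_diagonal i j hij
  rcases Nat.eq_zero_or_pos (M i j) with h0 | hpos
  · rw [h0, pow_zero]
  rcases (show M i j = 2 ∨ 3 ≤ M i j by omega) with h2 | h3
  · have hc : M.coroot j (Pi.single i 1) = 0 := by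
      rw [coroot_single, M.symmetric j i, h2]; simp
    have hc' : M.coroot i (Pi.single j 1) = 0 := by
      rw [coroot_single, h2]; simp
    ext1 v
    rw [h2, pow_two]
    simp only [LinearEquiv.mul_apply, reflection_apply, map_sub, map_smul, hc, hc',
      coroot_single_self, LinearEquiv.coe_one, id_eq]
    module
  ext1 v
  rw [reflection_mul_reflection_pow_apply]
  have ht : M.coroot i (Pi.single j 1) * M.coroot j (Pi.single i 1) - 2 =
      2 * cos (2 * (π / M i j)) := by
    rw [coroot_single, coroot_single, M.symmetric j i, cos_two_mul]; ring
  rw [ht]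
  have hm3 : (3 : ℝ) ≤ M i j := by exact_mod_cast h3
  have hsin : sin (2 * (π / M i j)) ≠ 0 := by
    refine (sin_pos_of_pos_of_lt_pi (by positivity) ?_).ne'
    rw [mul_div_assoc', div_lt_iff₀ (by linarith)]
    nlinarith [pi_pos]
  rcases Nat.even_or_odd' (M i j) with ⟨k, hk | hk⟩
  · have hS : (Polynomial.Chebyshev.S ℝ ((k : ℤ) - 1)).eval (2 * cos (2 * (π / M i j))) = 0 := by
      refine S_eval_eq_zero_of_sin hsin ?_
      have : ((((k : ℤ) - 1 : ℤ) : ℝ) + 1) * (2 * (π / M i j)) = π := by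
        rw [hk]; push_cast
        have : (k : ℝ) ≠ 0 := by
          rintro h
          rw [hk] at hm3
          push_cast at hm3
          linarith
        field_simp
        ring
      rw [this, sin_pi]
    have e1 : ((M i j : ℤ) - 2) / 2 = k - 1 := by omega
    have e2 : ((M i j : ℤ) - 1) / 2 = k - 1 := by omega
    rw [e1, e2, hS]
    simp
  · have hS : (Polynomial.Chebyshev.S ℝ (k : ℤ)).eval (2 * cos (2 * (π / M i j))) +
        (Polynomial.Chebyshev.S ℝ ((k : ℤ) - 1)).eval (2 * cos (2 * (π / M i j))) = 0 := by
      refine (mul_eq_zero.1 ?_).resolve_right hsin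
      rw [add_mul, Polynomial.Chebyshev.S_two_mul_real_cos, Polynomial.Chebyshev.S_two_mul_real_cos]
      have : (((k : ℤ) : ℝ) + 1) * (2 * (π / M i j)) =
          2 * π - ((((k : ℤ) - 1 : ℤ) : ℝ) + 1) * (2 * (π / M i j)) := by
        have hne : (M i j : ℝ) ≠ 0 := by linarith
        have hk' : (M i j : ℝ) = 2 * k + 1 := by exact_mod_cast hk
        field_simp
        rw [hk']
        push_cast
        ring
      rw [this, sin_two_pi_sub, neg_add_cancel]
    have e1 : ((M i j : ℤ) - 2) / 2 = k - 1 := by omega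
    have e2 : ((M i j : ℤ) - 1) / 2 = k := by omega
    have e3 : ((M i j : ℤ) - 3) / 2 = k - 1 := by omega
    have e4 : (M i j : ℤ) / 2 = k := by omega
    rw [e1, e2, e3, e4, hS]
    simp

/-- The geometric representation. -/
noncomputable def geometricRep {W : Type*} [Group W] (cs : CoxeterSystem M W) :
    W →* ((Fin n → ℝ) ≃ₗ[ℝ] (Fin n → ℝ)) :=
  cs.lift ⟨fun i => reflection (M.coroot_single_self i), M.reflection_mul_reflection_pow_eq_one⟩

theorem geometricRep_simple {W : Type*} [Group W] (cs : CoxeterSystem M W) (i : Fin n)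
    (v : Fin n → ℝ) :
    M.geometricRep cs (cs.simple i) v = v - M.coroot i v • Pi.single i 1 := by
  have : M.geometricRep cs (cs.simple i) = reflection (M.coroot_single_self i) :=
    cs.lift_apply_simple _ i
  rw [this, reflection_apply]

end CoxeterMatrix

/-! ### The Coxeter element lies in no proper parabolic subgroup -/

namespace DualCoxeter

variable {n : ℕ} {M : CoxeterMatrix (Fin n)} {W : Type*} [Group W] (cs : CoxeterSystem M W)

/-- The elements that leave the coordinate of the simple root `αᵢ` unchanged. -/
noncomputable def coordFixer (i : Fin n) : Subgroup W where
  carrier := {u | ∀ v, M.geometricRep cs u v i = v i}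
  mul_mem' {a b} ha hb v := by rw [map_mul, LinearEquiv.mul_apply, ha, hb]
  one_mem' v := by rw [map_one]; rfl
  inv_mem' {a} ha v := by
    rw [← ha (M.geometricRep cs a⁻¹ v), ← LinearEquiv.mul_apply, ← map_mul, mul_inv_cancel,
      map_one]; rfl

theorem simple_mem_coordFixer_iff {i j : Fin n} : cs.simple j ∈ coordFixer cs i ↔ j ≠ i := by
  constructor
  · rintro h rfl
    have := h (Pi.single j 1)
    rw [CoxeterMatrix.geometricRep_simple, CoxeterMatrix.coroot_single_self] at this
    norm_num at this
  · intro h v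
    rw [CoxeterMatrix.geometricRep_simple]
    simp [h.symm]

theorem parabolic_le_coordFixer {T : Finset (Fin n)} {i : Fin n} (hi : i ∉ T) :
    parabolic cs T ≤ coordFixer cs i := by
  rw [parabolic, Subgroup.closure_le]
  rintro _ ⟨j, hj, rfl⟩
  exact (simple_mem_coordFixer_iff cs).2 fun h => hi (h ▸ hj)

theorem coxeterElement_notMem_parabolic {T : Finset (Fin n)} (hT : T ≠ Finset.univ) :
    coxeterElement cs ∉ parabolic cs T := by
  obtain ⟨i, hi⟩ : ∃ i, i ∉ T := by
    by_contra! h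
    exact hT (Finset.eq_univ_iff_forall.2 h)
  intro h
  have h := parabolic_le_coordFixer cs hi h
  rw [coxeterElement, List.ofFn_eq_map] at h
  obtain ⟨a, b, hab⟩ := List.append_of_mem (List.mem_finRange i)
  have hnd := List.nodup_finRange n
  rw [hab, List.nodup_middle, List.nodup_cons, List.mem_append, not_or] at hnd
  have key : ∀ l : List (Fin n), i ∉ l → (l.map cs.simple).prod ∈ coordFixer cs i := by
    intro l hl
    refine Subgroup.list_prod_mem _ fun x hx => ?_
    obtain ⟨j, hj, rfl⟩ := List.mem_map.1 hx
    exact (simple_mem_coordFixer_iff cs).2 fun h => hl (h ▸ hj)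
  -- All factors of w except the single s_i can be cancelled within `coordFixer`, so membership of w
  -- would force membership of s_i.
  rw [hab, List.map_append, List.map_cons, List.prod_append, List.prod_cons,
    Subgroup.mul_mem_cancel_left _ (key a hnd.1.1),
    Subgroup.mul_mem_cancel_right _ (key b hnd.1.2)] at h
  exact (simple_mem_coordFixer_iff cs).1 h rfl

end DualCoxeter

/-! ### Matchings on directed lines and cycles -/

open Relation

/-- The elements from which `S` can be reached. -/
def Reaches {P : Type*} (Step : P → P → Prop) (S : Set P) : Set P :=
  {p | ∃ r ∈ S, ReflTransGen Step p r}

/-- A graph whose components are directed lines and cycles, with alternating `High` and low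
vertices, and a set `S` of low vertices. -/
structure IsLineGraph {P : Type*} (Step : P → P → Prop) (High : P → Prop) (S : Set P) : Prop where
  right_unique : ∀ {a b c}, Step a b → Step a c → b = c
  left_unique : ∀ {a b c}, Step a c → Step b c → a = b
  alternating : ∀ {a b}, Step a b → (High a ↔ ¬ High b)
  low : ∀ {a}, a ∈ S → ¬ High a

/-- The matching of the high elements from which `S` cannot be reached with their successors. -/
def forwardMatching {P : Type*} (Step : P → P → Prop) (High : P → Prop) (S : Set P) :
    Set (P × P) :=
  {e | High e.2 ∧ e.2 ∉ Reaches Step S ∧ Step e.2 e.1}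

/-- The matching of a line graph towards `S`. -/
def lineMatching {P : Type*} (Step : P → P → Prop) (High : P → Prop) (S : Set P) : Set (P × P) :=
  forwardMatching Step High S ∪ forwardMatching (Function.swap Step) High S

/-- The edges of a line graph, oriented upwards if they are matched and downwards otherwise. -/
def LineArrow {P : Type*} (Step : P → P → Prop) (High : P → Prop) (S : Set P) (p q : P) : Prop :=
  (p, q) ∈ lineMatching Step High S ∨
    High p ∧ (Step p q ∨ Step q p) ∧ (q, p) ∉ lineMatching Step High S

section

variable {P : Type*} {Step : P → P → Prop} {High : P → Prop} {S : Set P}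

theorem subset_reaches : S ⊆ Reaches Step S := fun p hp => ⟨p, hp, .refl⟩

theorem mem_reaches_of_step {a b : P} (h : Step a b) (hb : b ∈ Reaches Step S) :
    a ∈ Reaches Step S := by
  obtain ⟨r, hr, hbr⟩ := hb
  exact ⟨r, hr, .head h hbr⟩

theorem mem_reaches_swap {p : P} :
    p ∈ Reaches (Function.swap Step) S ↔ ∃ r ∈ S, ReflTransGen Step r p := by
  simp only [Reaches, Set.mem_ofPred_eq, reflTransGen_swap]

namespace IsLineGraph

theorem swap (h : IsLineGraph Step High S) : IsLineGraph (Function.swap Step) High S where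
  right_unique h1 h2 := h.left_unique h1 h2
  left_unique h1 h2 := h.right_unique h1 h2
  alternating h1 := by have := h.alternating h1; tauto
  low := h.low

theorem reaches_of_step_left (h : IsLineGraph Step High S)
    {a b : P} (hs : Step a b) (ha : a ∈ Reaches Step S) (haS : a ∉ S) :
    b ∈ Reaches Step S := by
  obtain ⟨r, hr, har⟩ := ha
  rcases har.cases_head with rfl | ⟨c, hc, hcr⟩
  · exact absurd hr haS
  · rw [h.right_unique hs hc]
    exact ⟨r, hr, hcr⟩

/-- Steps are unique in both directions, so a change of direction only retraces the directed path.
-/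
theorem total (h : IsLineGraph Step High S)
    {a b : P} (hab : ReflTransGen (fun a b => Step a b ∨ Step b a) a b) :
    ReflTransGen Step a b ∨ ReflTransGen Step b a := by
  induction hab with
  | refl => exact Or.inl .refl
  | tail _ hs ih =>
    rcases ih with ih | ih <;> rcases hs with hs | hs
    · exact Or.inl (ih.tail hs)
    · rcases ih.cases_tail with rfl | ⟨c, hc, hcb⟩
      · exact Or.inr (.single hs)
      · rw [← h.left_unique hcb hs]
        exact Or.inl hc
    · rcases ih.cases_head with rfl | ⟨c, hbc, hc⟩
      · exact Or.inl (.single hs)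
      · rw [← h.right_unique hbc hs]
        exact Or.inr hc
    · exact Or.inr (ih.head hs)

/-- On a cycle everything can be reached. -/
theorem reaches_of_cycle (h : IsLineGraph Step High S)
    {p : P} (hc : TransGen Step p p)
    (hp : p ∈ Reaches (Function.swap Step) S) : p ∈ Reaches Step S := by
  obtain ⟨r, hr, hrp⟩ := mem_reaches_swap.1 hp
  refine ⟨r, hr, ?_⟩
  clear hr
  induction hrp using ReflTransGen.head_induction_on with
  | refl => exact .refl
  | head hs _ ih =>
    have : TransGen Step p _ := hc.trans_left ih
    obtain ⟨b, hb, hbc⟩ := TransGen.tail'_iff.1 this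
    rwa [h.left_unique hs hbc]

theorem forwardMatching_low (h : IsLineGraph Step High S)
    {e : P × P} (he : e ∈ forwardMatching Step High S) :
    ¬ High e.1 ∧ e.1 ∉ Reaches Step S :=
  ⟨(h.alternating he.2.2).1 he.1, fun h1 => he.2.1 (mem_reaches_of_step he.2.2 h1)⟩

/-- `S` cannot be reached from the elements on the edges of the matching. -/
theorem notMem_of_forwardMatching (h : IsLineGraph Step High S)
    {e : P × P} (he : e ∈ forwardMatching Step High S) {p : P}
    (hp : p = e.1 ∨ p = e.2) : p ∉ Reaches Step S := by
  rcases hp with rfl | rfl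
  · exact (h.forwardMatching_low he).2
  · exact he.2.1

theorem forwardMatching_eq (h : IsLineGraph Step High S)
    {e f : P × P} (he : e ∈ forwardMatching Step High S)
    (hf : f ∈ forwardMatching Step High S) {p : P} (hpe : p = e.1 ∨ p = e.2)
    (hpf : p = f.1 ∨ p = f.2) : e = f := by
  have h1 := (h.forwardMatching_low he).1
  have h2 := (h.forwardMatching_low hf).1
  have hs := he.2.2
  have ht := hf.2.2
  rcases hpe with rfl | rfl <;> rcases hpf with h3 | h3
  · rw [h3] at hs
    exact Prod.ext h3 (h.left_unique hs ht)
  · exact absurd (h3 ▸ hf.1) h1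
  · exact absurd (h3 ▸ he.1) h2
  · rw [h3] at hs
    exact Prod.ext (h.right_unique hs ht) h3

/-- If `p` reaches `S` only backwards, then the step into `p` starts from an element that reaches
`S` backwards. -/
theorem exists_step {p : P} (hp : p ∉ Reaches Step S) (hp' : p ∈ Reaches (Function.swap Step) S) :
    ∃ b, Step b p ∧ b ∈ Reaches (Function.swap Step) S := by
  obtain ⟨r, hr, hrp⟩ := mem_reaches_swap.1 hp'
  rcases hrp.cases_tail with rfl | ⟨b, hb, hbp⟩
  · exact absurd (subset_reaches hr) hp
  · exact ⟨b, hbp, mem_reaches_swap.2 ⟨r, hr, hb⟩⟩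

/-- Beyond `S`, a high vertex is paired with its successor and a low one with its predecessor.
`hnext` asks for a successor only when there is a predecessor, because a zero-dimensional simplex
with product w would have neither. -/
theorem exists_forwardMatching (h : IsLineGraph Step High S)
    {p : P} (hp : p ∉ Reaches Step S)
    (hp' : p ∈ Reaches (Function.swap Step) S) (hnext : ∀ b, Step b p → High p → ∃ c, Step p c) :
    ∃ e ∈ forwardMatching Step High S, (p = e.1 ∨ p = e.2) ∧
      e.1 ∈ Reaches (Function.swap Step) S ∧ e.2 ∈ Reaches (Function.swap Step) S := by
  obtain ⟨b, hbp, hb⟩ := exists_step hp hp'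
  by_cases hH : High p
  · obtain ⟨c, hc⟩ := hnext b hbp hH
    exact ⟨(c, p), ⟨hH, hp, hc⟩, Or.inr rfl, mem_reaches_of_step (Step := Function.swap Step) hc hp',
      hp'⟩
  · have hbH := (h.alternating hbp).2 hH
    refine ⟨(p, b), ⟨hbH, fun hbr => hp (h.reaches_of_step_left hbp hbr fun hbS => h.low hbS hbH),
      hbp⟩, Or.inl rfl, hp', hb⟩

/-- Induction from `S` along a line beyond the last element of `S`. -/
theorem beyond_induction {C : P → Prop}
    (base : ∀ p ∈ Reaches Step S, p ∈ Reaches (Function.swap Step) S → C p)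
    (step : ∀ p b, p ∉ Reaches Step S → Step b p → b ∈ Reaches (Function.swap Step) S → C b → C p)
    {p : P} (hp : p ∈ Reaches (Function.swap Step) S) : C p := by
  obtain ⟨r, hr, hrp⟩ := mem_reaches_swap.1 hp
  clear hp
  induction hrp with
  | refl => exact base _ (subset_reaches hr) (subset_reaches hr)
  | @tail b p hrb hbp ih =>
    by_cases hp : p ∈ Reaches Step S
    · exact base p hp (mem_reaches_swap.2 ⟨r, hr, hrb.tail hbp⟩)
    · exact step p b hp hbp (mem_reaches_swap.2 ⟨r, hr, hrb⟩) ih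

theorem mem_lineMatching_swap {e : P × P} :
    e ∈ lineMatching (Function.swap Step) High S ↔ e ∈ lineMatching Step High S :=
  or_comm

/-- The forward and backward matchings can only meet at vertices that reach `S` in neither
direction, which the assumption on `p` excludes. -/
theorem lineMatching_eq (h : IsLineGraph Step High S) {e f : P × P}
    (he : e ∈ lineMatching Step High S) (hf : f ∈ lineMatching Step High S) {p : P}
    (hpe : p = e.1 ∨ p = e.2) (hpf : p = f.1 ∨ p = f.2)
    (hp : p ∈ Reaches Step S ∨ p ∈ Reaches (Function.swap Step) S) : e = f := by
  rcases he with he | he <;> rcases hf with hf | hf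
  · exact h.forwardMatching_eq he hf hpe hpf
  · exact absurd hp (not_or.2
      ⟨h.notMem_of_forwardMatching he hpe, h.swap.notMem_of_forwardMatching hf hpf⟩)
  · exact absurd hp (not_or.2
      ⟨h.notMem_of_forwardMatching hf hpf, h.swap.notMem_of_forwardMatching he hpe⟩)
  · exact h.swap.forwardMatching_eq he hf hpe hpf

theorem notMem_of_lineMatching (h : IsLineGraph Step High S) {e : P × P}
    (he : e ∈ lineMatching Step High S) {p : P} (hp : p = e.1 ∨ p = e.2) :
    ¬ (p ∈ Reaches Step S ∧ p ∈ Reaches (Function.swap Step) S) := by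
  rintro ⟨h1, h2⟩
  rcases he with he | he
  · exact h.notMem_of_forwardMatching he hp h1
  · exact h.swap.notMem_of_forwardMatching he hp h2

/-- Well-founded induction along the arrows within a line. -/
theorem arrow_induction (h : IsLineGraph Step High S) {C : P → Prop}
    (hC : ∀ p, (∀ q, LineArrow Step High S p q → C q) → C p) {p : P}
    (hp : p ∈ Reaches (Function.swap Step) S) : C p := by
  -- Low vertices between elements of `S` have no outgoing arrows.
  have low : ∀ p ∈ Reaches Step S, p ∈ Reaches (Function.swap Step) S → ¬ High p → C p := by
    intro p h1 h2 hH
    refine hC p fun q hq => ?_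
    rcases hq with hq | hq
    · exact absurd ⟨h1, h2⟩ (h.notMem_of_lineMatching hq (Or.inl rfl))
    · exact absurd hq.1 hH
  refine beyond_induction ?_ ?_ hp
  · intro p h1 h2
    by_cases hH : High p
    · refine hC p fun q hq => ?_
      have hpS : p ∉ S := fun hS => h.low hS hH
      rcases hq with hq | ⟨-, hq | hq, -⟩
      · exact absurd ⟨h1, h2⟩ (h.notMem_of_lineMatching hq (Or.inl rfl))
      · exact low q (h.reaches_of_step_left hq h1 hpS)
          (mem_reaches_of_step (Step := Function.swap Step) hq h2) ((h.alternating hq).1 hH)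
      · exact low q (mem_reaches_of_step hq h1) (h.swap.reaches_of_step_left hq h2 hpS)
          fun hq' => (h.alternating hq).1 hq' hH
    · exact low p h1 h2 hH
  -- Beyond `S` every arrow from `p` goes to its predecessor `b`: upwards along the matching if `p`
  -- is low, downwards if `p` is high.
  · intro p b hp hbp hb hCb
    have hp' : p ∈ Reaches (Function.swap Step) S :=
      mem_reaches_of_step (Step := Function.swap Step) hbp hb
    refine hC p fun q hq => ?_
    rcases hq with (hq | hq) | ⟨hH, hq | hq, hM⟩
    · have hqp : Step q p := hq.2.2
      rwa [h.left_unique hqp hbp]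
    · exact absurd hp' (h.swap.notMem_of_forwardMatching hq (Or.inl rfl))
    · exact absurd (Or.inl ⟨hH, hp, hq⟩) hM
    · rwa [h.left_unique hq hbp]

end IsLineGraph

end

/-! ### Subcomplexes of cells reached by steps -/

namespace DeltaComplex

universe u

variable {X : DeltaComplex.{u}}

theorem exists_face_face {n : ℕ} (i : Fin (n + 3)) (k : Fin (n + 2)) (x : X.obj (n + 2)) :
    ∃ j ≠ i, ∃ k', X.face k (X.face i x) = X.face k' (X.face j x) := by
  obtain ⟨i', j', h1, -, -, h4⟩ := exists_succAbove_comm.{u} (Fin.succAbove_ne i k).symm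
  obtain rfl := Fin.succAbove_right_injective h1
  exact ⟨_, Fin.succAbove_ne i i', j', h4 X x⟩

theorem face_le {n : ℕ} (i : Fin (n + 2)) (x : X.obj (n + 1)) :
    (⟨n, X.face i x⟩ : X.Cell) ≤ ⟨n + 1, x⟩ :=
  Relation.ReflTransGen.single (.mk i x)

theorem le_cases {τ σ : X.Cell} (h : τ ≤ σ) : τ = σ ∨ ∃ n i, ∃ x : X.obj (n + 1),
    σ = ⟨n + 1, x⟩ ∧ τ ≤ ⟨n, X.face i x⟩ := by
  rcases Relation.ReflTransGen.cases_tail h with h | ⟨c, hc, hcs⟩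
  · exact Or.inl h.symm
  · obtain ⟨i, x⟩ := hcs
    exact Or.inr ⟨_, i, x, rfl, hc⟩

/-- A proper face of a simplex other than a given facet lies in another facet. -/
theorem le_cases_of_facet {n : ℕ} {x : X.obj (n + 1)} (i : Fin (n + 2)) {τ : X.Cell}
    (h : τ ≤ ⟨n + 1, x⟩) :
    τ = ⟨n + 1, x⟩ ∨ τ = ⟨n, X.face i x⟩ ∨ ∃ j ≠ i, τ ≤ ⟨n, X.face j x⟩ := by
  rcases le_cases h with h | ⟨m, j, y, he, hj⟩
  · exact Or.inl h
  cases he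
  by_cases hji : j = i
  · subst hji
    rcases le_cases hj with h | ⟨m, k, y, he, hk⟩
    · exact Or.inr (Or.inl h)
    obtain ⟨rfl, he⟩ := (Cell.mk.injEq _ _ _ _).mp he
    obtain rfl := eq_of_heq he
    obtain ⟨l, hl, k', he⟩ := exists_face_face j k x
    rw [he] at hk
    exact Or.inr (Or.inr ⟨l, hl, hk.trans (face_le _ _)⟩)
  · exact Or.inr (Or.inr ⟨j, hji, hj⟩)

/-- Suppose that the steps enter each high simplex from its facet number `e` and leave it towards
its facet number `o`, and that the other facets of a high simplex are high again. Then the cells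
that are reached from a lower set form a lower set. -/
theorem isLowerSet_reaches {Step : X.Cell → X.Cell → Prop} {High : X.Cell → Prop}
    (e o : ∀ n, Fin (n + 2))
    (hstep : ∀ a b, Step a b ↔ ∃ n, ∃ x : X.obj (n + 1), High ⟨n + 1, x⟩ ∧
      ((a = ⟨n + 1, x⟩ ∧ b = ⟨n, X.face (o n) x⟩) ∨ (a = ⟨n, X.face (e n) x⟩ ∧ b = ⟨n + 1, x⟩)))
    (hmid : ∀ n (x : X.obj (n + 1)) i, High ⟨n + 1, x⟩ → i ≠ e n → i ≠ o n →
      High ⟨n, X.face i x⟩)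
    (hone : ∀ i : Fin 2, i = e 0 ∨ i = o 0)
    (hface : ∀ n (x : X.obj (n + 2)) i, i ≠ e (n + 1) → i ≠ o (n + 1) →
      (⟨n, X.face (e n) (X.face i x)⟩ : X.Cell) ≤ ⟨n + 1, X.face (e (n + 1)) x⟩)
    {S : Set X.Cell} (hS : IsLowerSet S) : IsLowerSet (Reaches (Function.swap Step) S) := by
  set R := Reaches (Function.swap Step) S
  have hR : ∀ {a b}, Step a b → a ∈ R → b ∈ R := fun h ha =>
    mem_reaches_of_step (Step := Function.swap Step) h ha
  -- From the entry facet, steps reach `x` and then its exit facet. Any other facet is high again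
  -- and its own entry facet is a face of that of `x`, so induction applies to it. Proper faces of
  -- the exit facet lie in another facet.
  have key : ∀ n (x : X.obj (n + 1)), High ⟨n + 1, x⟩ → (∀ τ ≤ ⟨n, X.face (e n) x⟩, τ ∈ R) →
      ∀ τ ≤ ⟨n + 1, x⟩, τ ∈ R := by
    intro n
    induction n with
    | zero =>
      intro x hx hfx τ hτ
      have h1 := hR ((hstep _ _).2 ⟨_, x, hx, Or.inr ⟨rfl, rfl⟩⟩) (hfx _ le_rfl)
      rcases le_cases_of_facet (o 0) hτ with rfl | rfl | ⟨j, hj, hτj⟩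
      · exact h1
      · exact hR ((hstep _ _).2 ⟨_, x, hx, Or.inl ⟨rfl, rfl⟩⟩) h1
      · rw [(hone j).resolve_right hj] at hτj
        exact hfx τ hτj
    | succ n ih =>
      intro x hx hfx τ hτ
      have h1 := hR ((hstep _ _).2 ⟨_, x, hx, Or.inr ⟨rfl, rfl⟩⟩) (hfx _ le_rfl)
      rcases le_cases_of_facet (o (n + 1)) hτ with rfl | rfl | ⟨j, hj, hτj⟩
      · exact h1
      · exact hR ((hstep _ _).2 ⟨_, x, hx, Or.inl ⟨rfl, rfl⟩⟩) h1
      · by_cases hje : j = e (n + 1)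
        · subst hje
          exact hfx τ hτj
        · exact ih _ (hmid _ x j hx hje hj)
            (fun τ hτ => hfx τ (hτ.trans (hface n x j hje hj))) τ hτj
  intro σ τ hτσ hσ
  obtain ⟨ρ, hρ, hρσ⟩ := mem_reaches_swap.1 hσ
  clear hσ
  induction hρσ generalizing τ with
  | refl => exact subset_reaches (hS hτσ hρ)
  | tail _ hs ih =>
    obtain ⟨n, x, hx, ⟨rfl, rfl⟩ | ⟨rfl, rfl⟩⟩ := (hstep _ _).1 hs
    · exact ih (hτσ.trans (face_le _ _))
    · exact key n x hx (fun τ hτ => ih hτ) τ hτσ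

end DeltaComplex

/-! ### The interval complex of a Coxeter group -/

namespace DualCoxeter

open IntervalComplex DeltaComplex PosetMatching

variable {n : ℕ} {M : CoxeterMatrix (Fin n)} {W : Type*} [Group W] (cs : CoxeterSystem M W)

/-! ### Parabolic cells -/

theorem closure_parabolicReflections (T : Finset (Fin n)) :
    Submonoid.closure (parabolicReflections cs T) = ⊤ := by
  have hinv : ∀ x ∈ Submonoid.closure (parabolicReflections cs T),
      x⁻¹ ∈ Submonoid.closure (parabolicReflections cs T) := by
    intro x hx
    induction hx using Submonoid.closure_induction with
    | mem x hx =>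
      have hxx : x⁻¹ = x := by
        obtain ⟨u, i, -, hxi⟩ := hx
        refine Subtype.ext ?_
        rw [Subgroup.coe_inv, hxi]
        simp [mul_assoc]
      rw [hxx]
      exact Submonoid.subset_closure hx
    | one => simp
    | mul x y _ _ hx hy => rw [mul_inv_rev]; exact mul_mem hy hx
  rw [eq_top_iff]
  rintro ⟨x, hx⟩ -
  induction hx using Subgroup.closure_induction with
  | mem x hx =>
    obtain ⟨i, hi, rfl⟩ := hx
    exact Submonoid.subset_closure ⟨1, i, by simpa using hi, by simp⟩
  | one => exact one_mem _
  | mul x y hx hy ihx ihy => exact mul_mem ihx ihy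
  | inv x hx ih => exact hinv _ ih

theorem conj_mem_parabolicReflections (T : Finset (Fin n)) :
    ∀ r ∈ parabolicReflections cs T, ∀ u : parabolic cs T,
      u * r * u⁻¹ ∈ parabolicReflections cs T := by
  rintro r ⟨v, i, hi, hr⟩ u
  exact ⟨u * v, i, hi, by push_cast; rw [hr]; group⟩

theorem map_tupleFace {G H : Type*} [Group G] [Group H] (f : G →* H) {d : ℕ} (i : Fin (d + 2))
    (x : Fin (d + 1) → G) (k : Fin d) : f (tupleFace i x k) = tupleFace i (fun j => f (x j)) k := by
  have h : ∀ k : Fin (d + 2), f (Fin.partialProd x k) = Fin.partialProd (fun j => f (x j)) k := by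
    intro k
    induction k using Fin.induction with
    | zero => simp
    | succ k ih => rw [Fin.partialProd_succ, Fin.partialProd_succ, map_mul, ih]
  rw [← Fin.partialProd_right_inv (tupleFace i x) k,
    ← Fin.partialProd_right_inv (tupleFace i fun j => f (x j)) k]
  simp only [partialProd_tupleFace, map_mul, map_inv, h]

theorem isLowerSet_X'' : IsLowerSet (X'' cs) := by
  intro σ τ hτσ hσ
  change Relation.ReflTransGen _ τ σ at hτσ
  induction hτσ using Relation.ReflTransGen.head_induction_on with
  | refl => exact hσ
  | head h _ ih =>
    obtain ⟨T, hT, y, hy, hyx⟩ := ih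
    obtain ⟨i, x⟩ := h
    refine ⟨T, hT, tupleFace i y, hy.tupleFace (closure_parabolicReflections cs T)
      (conj_mem_parabolicReflections cs T) i, fun k => ?_⟩
    have := map_tupleFace (parabolic cs T).subtype i y k
    simp only [Subgroup.subtype_apply, hyx] at this
    exact this

/-! ### Fiber components -/

/-- The product of the entries of the simplex is the Coxeter element. -/
def IsTop (σ : (K cs).Cell) : Prop := (List.ofFn σ.simplex.1).prod = coxeterElement cs

theorem eta_of_isTop {σ : (K cs).Cell} (h : IsTop cs σ) : eta cs σ = σ.dim := if_pos h

theorem eta_of_not_isTop {σ : (K cs).Cell} (h : ¬ IsTop cs σ) : eta cs σ = σ.dim + 1 := if_neg h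

theorem dim_le_eta (σ : (K cs).Cell) : σ.dim ≤ eta cs σ := by
  by_cases h : IsTop cs σ
  · rw [eta_of_isTop cs h]
  · rw [eta_of_not_isTop cs h]; omega

theorem eta_le (σ : (K cs).Cell) : eta cs σ ≤ σ.dim + 1 := by
  by_cases h : IsTop cs σ
  · rw [eta_of_isTop cs h]; omega
  · rw [eta_of_not_isTop cs h]

theorem not_isTop_of_mem_X'' {σ : (K cs).Cell} (h : σ ∈ X'' cs) : ¬ IsTop cs σ := by
  obtain ⟨T, hT, y, -, hy⟩ := h
  intro htop
  refine coxeterElement_notMem_parabolic cs hT ?_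
  rw [← show (List.ofFn σ.simplex.1).prod = coxeterElement cs from htop]
  refine Subgroup.list_prod_mem _ fun x hx => ?_
  obtain ⟨i, rfl⟩ := (List.mem_ofFn' _ _).1 hx
  rw [← hy i]
  exact (y i).2

theorem prod_face {d : ℕ} (x : (K cs).obj (d + 1)) (i : Fin (d + 2)) :
    (List.ofFn ((K cs).face i x).1).prod = (Fin.partialProd x.1 (i.succAbove 0))⁻¹ *
      Fin.partialProd x.1 (i.succAbove (Fin.last d)) := by
  rw [← partialProd_last]
  exact partialProd_tupleFace i x.1 (Fin.last d)

theorem prod_face_zero {d : ℕ} (x : (K cs).obj (d + 1)) :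
    x.1 0 * (List.ofFn ((K cs).face 0 x).1).prod = (List.ofFn x.1).prod := by
  rw [List.ofFn_succ, List.prod_cons]
  rfl

theorem prod_face_last {d : ℕ} (x : (K cs).obj (d + 1)) :
    (List.ofFn ((K cs).face (Fin.last (d + 1)) x).1).prod * x.1 (Fin.last d) =
      (List.ofFn x.1).prod := by
  rw [show ((K cs).face (Fin.last (d + 1)) x).1 = Fin.init x.1 from tupleFace_last x.1,
    List.ofFn_succ', List.prod_concat]
  rfl

theorem isTop_face {d : ℕ} {x : (K cs).obj (d + 1)} {i : Fin (d + 2)} (hx : IsTop cs ⟨d + 1, x⟩)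
    (h0 : i ≠ 0) (hl : i ≠ Fin.last (d + 1)) : IsTop cs ⟨d, (K cs).face i x⟩ := by
  refine (prod_face cs x i).trans ?_
  rw [Fin.succAbove_ne_zero_zero h0, Fin.succAbove_ne_last_last hl, Fin.partialProd_zero, inv_one,
    one_mul, partialProd_last]
  exact hx

theorem not_isTop_face_zero {d : ℕ} {x : (K cs).obj (d + 1)} (hx : IsTop cs ⟨d + 1, x⟩) :
    ¬ IsTop cs ⟨d, (K cs).face 0 x⟩ := by
  intro h
  have := prod_face_zero cs x
  rw [show (List.ofFn x.1).prod = _ from hx, show (List.ofFn ((K cs).face 0 x).1).prod = _ from h,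
    mul_eq_right] at this
  exact (x.2.1 0).2 this

theorem not_isTop_face_last {d : ℕ} {x : (K cs).obj (d + 1)} (hx : IsTop cs ⟨d + 1, x⟩) :
    ¬ IsTop cs ⟨d, (K cs).face (Fin.last (d + 1)) x⟩ := by
  intro h
  have := prod_face_last cs x
  rw [show (List.ofFn x.1).prod = _ from hx,
    show (List.ofFn ((K cs).face (Fin.last (d + 1)) x).1).prod = _ from h, mul_eq_left] at this
  exact (x.2.1 _).2 this

theorem face_zero_inj {d : ℕ} {x y : (K cs).obj (d + 1)} (hx : IsTop cs ⟨d + 1, x⟩)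
    (hy : IsTop cs ⟨d + 1, y⟩) (h : (K cs).face 0 x = (K cs).face 0 y) : x = y := by
  have h1 := (prod_face_zero cs x).trans (hx.trans (hy.symm.trans (prod_face_zero cs y).symm))
  rw [h] at h1
  have h2 := mul_right_cancel h1
  have h3 : Fin.tail x.1 = Fin.tail y.1 := congrArg Subtype.val h
  refine Subtype.ext ?_
  rw [← Fin.cons_self_tail x.1, ← Fin.cons_self_tail y.1, h3]
  exact congrArg (fun a => (Fin.cons a _ : Fin (d + 1) → W)) h2

theorem face_last_inj {d : ℕ} {x y : (K cs).obj (d + 1)} (hx : IsTop cs ⟨d + 1, x⟩)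
    (hy : IsTop cs ⟨d + 1, y⟩)
    (h : (K cs).face (Fin.last (d + 1)) x = (K cs).face (Fin.last (d + 1)) y) : x = y := by
  have h1 := (prod_face_last cs x).trans (hx.trans (hy.symm.trans (prod_face_last cs y).symm))
  rw [h] at h1
  have h2 := mul_left_cancel h1
  have h3 : Fin.init x.1 = Fin.init y.1 :=
    (tupleFace_last x.1).symm.trans ((congrArg Subtype.val h).trans (tupleFace_last y.1))
  refine Subtype.ext ?_
  rw [← Fin.snoc_init_self x.1, ← Fin.snoc_init_self y.1, h3, h2]

theorem stepRight_iff {a b : (K cs).Cell} : StepRight cs a b ↔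
    ∃ d, ∃ x : (K cs).obj (d + 1), IsTop cs ⟨d + 1, x⟩ ∧
      ((a = ⟨d + 1, x⟩ ∧ b = ⟨d, (K cs).face 0 x⟩) ∨
        (a = ⟨d, (K cs).face (Fin.last (d + 1)) x⟩ ∧ b = ⟨d + 1, x⟩)) := by
  constructor
  · rintro (⟨x, hx⟩ | ⟨x, hx⟩)
    · exact ⟨_, x, hx, Or.inl ⟨rfl, rfl⟩⟩
    · exact ⟨_, x, hx, Or.inr ⟨rfl, rfl⟩⟩
  · rintro ⟨d, x, hx, ⟨rfl, rfl⟩ | ⟨rfl, rfl⟩⟩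
    · exact .dropFirst x hx
    · exact .addLast x hx

theorem swap_stepRight_iff {a b : (K cs).Cell} : Function.swap (StepRight cs) a b ↔
    ∃ d, ∃ x : (K cs).obj (d + 1), IsTop cs ⟨d + 1, x⟩ ∧
      ((a = ⟨d + 1, x⟩ ∧ b = ⟨d, (K cs).face (Fin.last (d + 1)) x⟩) ∨
        (a = ⟨d, (K cs).face 0 x⟩ ∧ b = ⟨d + 1, x⟩)) := by
  rw [Function.swap, stepRight_iff]
  refine exists_congr fun d => exists_congr fun x => and_congr_right fun _ => ?_
  rw [or_comm, and_comm, and_comm (a := b = _)]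

/-- Knowing that the product is w recovers the omitted first or last entry, and neither outer facet
has product w again. Hence the two kinds of step never share a source or a target. -/
theorem isLineGraph : IsLineGraph (StepRight cs) (IsTop cs) (X'' cs) where
  right_unique {a b c} h1 h2 := by
    obtain ⟨d, x, hx, ⟨ha, rfl⟩ | ⟨ha, rfl⟩⟩ := (stepRight_iff cs).1 h1 <;>
    obtain ⟨d', y, hy, ⟨ha', rfl⟩ | ⟨ha', rfl⟩⟩ := (stepRight_iff cs).1 h2 <;>
    rw [ha] at ha'
    · cases ha'; rfl
    · rw [ha'] at hx; exact absurd hx (not_isTop_face_last cs hy)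
    · rw [← ha'] at hy; exact absurd hy (not_isTop_face_last cs hx)
    · obtain ⟨rfl, he⟩ := (Cell.mk.injEq _ _ _ _).mp ha'
      rw [face_last_inj cs hx hy (eq_of_heq he)]
  left_unique {a b c} h1 h2 := by
    obtain ⟨d, x, hx, ⟨rfl, ha⟩ | ⟨rfl, ha⟩⟩ := (stepRight_iff cs).1 h1 <;>
    obtain ⟨d', y, hy, ⟨rfl, ha'⟩ | ⟨rfl, ha'⟩⟩ := (stepRight_iff cs).1 h2 <;>
    rw [ha] at ha'
    · obtain ⟨rfl, he⟩ := (Cell.mk.injEq _ _ _ _).mp ha'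
      rw [face_zero_inj cs hx hy (eq_of_heq he)]
    · rw [← ha'] at hy; exact absurd hy (not_isTop_face_zero cs hx)
    · rw [ha'] at hx; exact absurd hx (not_isTop_face_zero cs hy)
    · cases ha'; rfl
  alternating h := by
    obtain ⟨d, x, hx, ⟨rfl, rfl⟩ | ⟨rfl, rfl⟩⟩ := (stepRight_iff cs).1 h
    · exact iff_of_true hx (not_isTop_face_zero cs hx)
    · exact iff_of_false (not_isTop_face_last cs hx) (not_not.2 hx)
  low h := not_isTop_of_mem_X'' cs h

theorem isFacet_of_step {σ τ : (K cs).Cell} (hσ : IsTop cs σ)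
    (h : StepRight cs σ τ ∨ StepRight cs τ σ) : (K cs).IsFacet τ σ := by
  rcases h with h | h <;>
    obtain ⟨d, x, hx, ⟨rfl, rfl⟩ | ⟨rfl, rfl⟩⟩ := (stepRight_iff cs).1 h
  · exact .mk _ _
  · exact absurd hσ (not_isTop_face_last cs hx)
  · exact absurd hσ (not_isTop_face_zero cs hx)
  · exact .mk _ _

theorem eta_eq_of_stepRight {a b : (K cs).Cell} (h : StepRight cs a b) :
    eta cs a = eta cs b := by
  obtain ⟨d, x, hx, ⟨rfl, rfl⟩ | ⟨rfl, rfl⟩⟩ := (stepRight_iff cs).1 h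
  · rw [eta_of_isTop cs hx, eta_of_not_isTop cs (not_isTop_face_zero cs hx)]
  · rw [eta_of_isTop cs hx, eta_of_not_isTop cs (not_isTop_face_last cs hx)]

/-- If the product of σ is not w, every facet has smaller η. If it is w, inner facets keep the
product and lose a dimension. Only the two outer facets in the second case remain. -/
theorem step_of_isFacet {σ τ : (K cs).Cell} (h : (K cs).IsFacet τ σ)
    (he : eta cs τ = eta cs σ) : IsTop cs σ ∧ (StepRight cs σ τ ∨ StepRight cs τ σ) := by
  obtain ⟨i, x⟩ := h
  have hx : IsTop cs ⟨_ + 1, x⟩ := by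
    by_contra hx
    have := eta_le cs ⟨_, (K cs).face i x⟩
    rw [he, eta_of_not_isTop cs hx] at this
    simp at this
  refine ⟨hx, ?_⟩
  by_cases h0 : i = 0
  · subst h0
    exact Or.inl (.dropFirst x hx)
  by_cases hl : i = Fin.last _
  · subst hl
    exact Or.inr (.addLast x hx)
  · have := eta_of_isTop cs (isTop_face cs hx h0 hl)
    rw [he, eta_of_isTop cs hx] at this
    simp at this

theorem eta_le_of_isFacet {σ τ : (K cs).Cell} (h : (K cs).IsFacet τ σ) :
    eta cs τ ≤ eta cs σ := by
  have h1 := eta_le cs τ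
  have h2 := dim_le_eta cs σ
  have := h.dim_eq
  omega

theorem hasse_adj_and_eta_iff {a b : (K cs).Cell} :
    ((SimpleGraph.hasse (K cs).Cell).Adj a b ∧ eta cs a = eta cs b) ↔
      (StepRight cs a b ∨ StepRight cs b a) := by
  rw [SimpleGraph.hasse_adj, cell_covBy_iff, cell_covBy_iff]
  constructor
  · rintro ⟨h | h, he⟩
    · exact (step_of_isFacet cs h he).2.symm
    · exact (step_of_isFacet cs h he.symm).2
  · intro h
    have he : eta cs a = eta cs b := by
      rcases h with h | h
      · exact eta_eq_of_stepRight cs h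
      · exact (eta_eq_of_stepRight cs h).symm
    refine ⟨?_, he⟩
    by_cases ha : IsTop cs a
    · exact Or.inr (isFacet_of_step cs ha h)
    · have hb : IsTop cs b := by
        rcases h with h | h
        · exact not_not.1 fun hb => ha (((isLineGraph cs).alternating h).2 hb)
        · exact ((isLineGraph cs).alternating h).2 ha
      exact Or.inl (isFacet_of_step cs hb h.symm)

theorem sameFiberComponent_iff {σ τ : (K cs).Cell} : SameFiberComponent cs σ τ ↔
    Relation.ReflTransGen (fun a b => StepRight cs a b ∨ StepRight cs b a) σ τ := by
  simp only [SameFiberComponent, hasse_adj_and_eta_iff]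

theorem K''_eq : K'' cs =
    Reaches (StepRight cs) (X'' cs) ∪ Reaches (Function.swap (StepRight cs)) (X'' cs) := by
  ext σ
  rw [Set.mem_union, mem_reaches_swap (Step := StepRight cs)]
  constructor
  · rintro ⟨ρ, hρ, h⟩
    rcases (isLineGraph cs).total ((sameFiberComponent_iff cs).1 h) with h | h
    · exact Or.inl ⟨ρ, hρ, h⟩
    · exact Or.inr ⟨ρ, hρ, h⟩
  · rintro (⟨ρ, hρ, h⟩ | ⟨ρ, hρ, h⟩)
    · exact ⟨ρ, hρ, (sameFiberComponent_iff cs).2 (Relation.ReflTransGen.mono (fun _ _ => Or.inl) _ _ h)⟩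
    · refine ⟨ρ, hρ, (sameFiberComponent_iff cs).2 ?_⟩
      exact Relation.ReflTransGen.mono (fun _ _ => Or.inr) _ _ (Relation.reflTransGen_swap.2 h)

theorem K'_eq : K' cs =
    Reaches (StepRight cs) (X'' cs) ∩ Reaches (Function.swap (StepRight cs)) (X'' cs) := by
  ext σ
  rw [Set.mem_inter_iff, mem_reaches_swap (Step := StepRight cs), and_comm]
  rfl

theorem isLowerSet_reaches_swap :
    IsLowerSet (Reaches (Function.swap (StepRight cs)) (X'' cs)) := by
  refine isLowerSet_reaches (Step := StepRight cs) (High := IsTop cs) (fun n => Fin.last (n + 1))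
    (fun n => 0) (fun a b => stepRight_iff cs) (fun d x i hx hl h0 => isTop_face cs hx h0 hl)
    (fun i => ?_) (fun d x i hl _ => ?_) (isLowerSet_X'' cs)
  · fin_cases i <;> simp
  · obtain ⟨i, rfl⟩ := Fin.exists_castSucc_eq.2 hl
    rw [← (K cs).face_face i (Fin.last (d + 1)) x (Fin.le_last _)]
    exact face_le _ _

theorem isLowerSet_reaches_stepRight : IsLowerSet (Reaches (StepRight cs) (X'' cs)) := by
  refine isLowerSet_reaches (Step := Function.swap (StepRight cs)) (High := IsTop cs) (fun n => 0)
    (fun n => Fin.last (n + 1)) (fun a b => swap_stepRight_iff cs)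
    (fun d x i hx h0 hl => isTop_face cs hx h0 hl)
    (fun i => ?_) (fun d x i h0 _ => ?_) (isLowerSet_X'' cs)
  · fin_cases i <;> simp
  · obtain ⟨i, rfl⟩ := Fin.exists_succ_eq.2 h0
    rw [(K cs).face_face 0 i x (Fin.zero_le _)]
    exact face_le _ _

theorem isLowerSet_K'' : IsLowerSet (K'' cs) := by
  rw [K''_eq]
  exact (isLowerSet_reaches_stepRight cs).union (isLowerSet_reaches_swap cs)

theorem isLowerSet_K' : IsLowerSet (K' cs) := by
  rw [K'_eq]
  exact (isLowerSet_reaches_stepRight cs).inter (isLowerSet_reaches_swap cs)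

theorem K'_subset_K'' : K' cs ⊆ K'' cs := by
  rw [K'_eq, K''_eq]
  exact fun σ h => Or.inl h.1

/-! ### The matching -/

/-- Beyond the last simplex of `X_W''` in one direction along a fiber component, the simplices are
matched in pairs, so that each pair ends farther away with its smaller simplex. -/
def matching : Set (K'' cs × K'' cs) :=
  {e | ((e.1 : (K cs).Cell), (e.2 : (K cs).Cell)) ∈
    lineMatching (StepRight cs) (IsTop cs) (X'' cs)}

theorem step_of_lineMatching {e : (K cs).Cell × (K cs).Cell}
    (he : e ∈ lineMatching (StepRight cs) (IsTop cs) (X'' cs)) :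
    IsTop cs e.2 ∧ (StepRight cs e.2 e.1 ∨ StepRight cs e.1 e.2) := by
  rcases he with he | he
  · exact ⟨he.1, Or.inl he.2.2⟩
  · exact ⟨he.1, Or.inr he.2.2⟩

theorem mem_reaches (p : K'' cs) : (p : (K cs).Cell) ∈ Reaches (StepRight cs) (X'' cs) ∨
    (p : (K cs).Cell) ∈ Reaches (Function.swap (StepRight cs)) (X'' cs) :=
  (K''_eq cs).subset p.2

theorem isMatching_matching : IsMatching (matching cs) := by
  constructor
  · intro e he
    have := step_of_lineMatching cs he
    exact (covBy_iff_isFacet (isLowerSet_K'' cs)).2 (isFacet_of_step cs this.1 this.2)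
  · intro e he f hf hne
    rw [Set.disjoint_left]
    intro p hpe hpf
    refine hne ?_
    have hpe : p = e.1 ∨ p = e.2 := hpe
    have hpf : p = f.1 ∨ p = f.2 := hpf
    have := (isLineGraph cs).lineMatching_eq he hf (p := p)
      (hpe.imp (congrArg _) (congrArg _)) (hpf.imp (congrArg _) (congrArg _)) (mem_reaches cs p)
    exact Prod.ext (Subtype.ext (congrArg Prod.fst this)) (Subtype.ext (congrArg Prod.snd this))

theorem sameFiberComponent_of_mem_matching {e : K'' cs × K'' cs} (he : e ∈ matching cs) :
    SameFiberComponent cs e.1 e.2 :=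
  (sameFiberComponent_iff cs).2 (.single (step_of_lineMatching cs he).2.symm)

/-- Inner facets keep the product w, so the matched facet is an outer one. If both outer facets
coincided, the component would be a 2-cycle on which `X''` is reached in both directions and nothing
is matched. -/
theorem isRegularFace_of_mem_matching {e : K'' cs × K'' cs} (he : e ∈ matching cs) :
    (K cs).IsRegularFace e.1 e.2 := by
  obtain ⟨⟨τ, hτ⟩, ⟨σ, hσ⟩⟩ := e
  have hor := mem_reaches cs ⟨σ, hσ⟩
  have htop := (step_of_lineMatching cs he).1
  -- two different facets in the same fiber component would give a cycle
  have hcyc : StepRight cs σ τ → StepRight cs τ σ → False := by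
    intro h1 h2
    rcases he with ⟨-, h, -⟩ | ⟨-, h, -⟩
    · exact h ((isLineGraph cs).reaches_of_cycle (.tail (.single h1) h2) (hor.resolve_left h))
    · exact h ((isLineGraph cs).swap.reaches_of_cycle (.tail (.single h2) h1) (hor.resolve_right h))
  have hfacet := isFacet_of_step cs htop (step_of_lineMatching cs he).2
  have hτtop : ¬ IsTop cs τ := by
    rcases he with he | he
    · exact ((isLineGraph cs).forwardMatching_low he).1
    · exact ((isLineGraph cs).swap.forwardMatching_low he).1
  obtain ⟨i, x⟩ := hfacet
  refine ⟨_, x, _, rfl, rfl, i, rfl, fun j hj => ?_⟩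
  have hi : i = 0 ∨ i = Fin.last _ := by
    by_contra! hi
    exact hτtop (isTop_face cs htop hi.1 hi.2)
  have hj' : j = 0 ∨ j = Fin.last _ := by
    by_contra! hi
    have := isTop_face cs htop hi.1 hi.2
    rw [hj] at this
    exact hτtop this
  rcases hi with rfl | rfl <;> rcases hj' with rfl | rfl
  · rfl
  · exact (hcyc (.dropFirst x htop) (hj ▸ .addLast x htop)).elim
  · exact (hcyc (hj ▸ .dropFirst x htop) (.addLast x htop)).elim
  · rfl

theorem isCritical_matching_iff (σ : K'' cs) :
    IsCritical (matching cs) σ ↔ (σ : (K cs).Cell) ∈ K' cs := by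
  rw [K'_eq]
  constructor
  · intro hσ
    have key : ∀ e ∈ lineMatching (StepRight cs) (IsTop cs) (X'' cs), e.1 ∈ K'' cs →
        e.2 ∈ K'' cs → (σ : (K cs).Cell) = e.1 ∨ (σ : (K cs).Cell) = e.2 → False := by
      intro e he h1 h2 hor
      have := hσ (⟨e.1, h1⟩, ⟨e.2, h2⟩) he
      rcases hor with h | h
      · exact this.1 (Subtype.ext h)
      · exact this.2 (Subtype.ext h)
    have hK := (K''_eq cs).superset
    constructor
    · by_contra h
      obtain ⟨e, he, hor, h1, h2⟩ := (isLineGraph cs).exists_forwardMatching h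
        ((mem_reaches cs σ).resolve_left h) fun b hb hp => by
          obtain ⟨d, x, hx, ⟨-, hσx⟩ | ⟨-, hσx⟩⟩ := (stepRight_iff cs).1 hb
          · rw [hσx] at hp
            exact absurd hp (not_isTop_face_zero cs hx)
          · rw [hσx]
            exact ⟨_, .dropFirst x hx⟩
      exact key e (Or.inl he) (hK (Or.inr h1)) (hK (Or.inr h2)) hor
    · by_contra h
      obtain ⟨e, he, hor, h1, h2⟩ := (isLineGraph cs).swap.exists_forwardMatching h
        ((mem_reaches cs σ).resolve_right h) fun b hb hp => by
          obtain ⟨d, x, hx, ⟨hσx, -⟩ | ⟨hσx, -⟩⟩ := (stepRight_iff cs).1 hb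
          · rw [hσx]
            exact ⟨_, .addLast x hx⟩
          · rw [hσx] at hp
            exact absurd hp (not_isTop_face_last cs hx)
      exact key e (Or.inr he) (hK (Or.inl h1)) (hK (Or.inl h2)) hor
  · intro hσ e he
    have := fun hor => (isLineGraph cs).notMem_of_lineMatching he (p := σ) hor hσ
    exact ⟨fun h => this (Or.inl (congrArg _ h)), fun h => this (Or.inr (congrArg _ h))⟩

theorem eta_lt_or_lineArrow {p q : K'' cs} (h : Arrow (matching cs) p q) :
    eta cs q < eta cs p ∨
      (eta cs q = eta cs p ∧ LineArrow (StepRight cs) (IsTop cs) (X'' cs) p q) := by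
  rcases h with h | ⟨h, hM⟩
  · right
    refine ⟨?_, Or.inl h⟩
    rcases (step_of_lineMatching cs h).2 with h | h
    · exact eta_eq_of_stepRight cs h
    · exact (eta_eq_of_stepRight cs h).symm
  · rw [covBy_iff_isFacet (isLowerSet_K'' cs)] at h
    rcases (eta_le_of_isFacet cs h).lt_or_eq with he | he
    · exact Or.inl he
    · have := step_of_isFacet cs h he
      exact Or.inr ⟨he, Or.inr ⟨this.1, this.2, hM⟩⟩

/-- Strong induction on η, and inside a fiber `arrow_induction` for the line or its reverse,
depending on the side from which the simplex reaches `X''`. -/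
theorem wellFounded_arrow : WellFounded fun q p => Arrow (matching cs) p q := by
  have key : ∀ k, ∀ p : K'' cs, eta cs p = k →
      Acc (fun q p => Arrow (matching cs) p q) p := by
    intro k
    induction k using Nat.strong_induction_on with
    | _ k ih =>
      have hC : ∀ p : (K cs).Cell,
          (∀ q, LineArrow (StepRight cs) (IsTop cs) (X'' cs) p q →
            ∀ h : q ∈ K'' cs, eta cs q = k → Acc (fun q p => Arrow (matching cs) p q) ⟨q, h⟩) →
          ∀ h : p ∈ K'' cs, eta cs p = k → Acc (fun q p => Arrow (matching cs) p q) ⟨p, h⟩ := by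
        intro p hp h hk
        refine Acc.intro _ fun q hq => ?_
        rcases eta_lt_or_lineArrow cs hq with hlt | ⟨he, hl⟩
        · exact ih _ (hk ▸ hlt) q rfl
        · exact hp q hl q.2 (he.trans hk)
      intro p hk
      rcases mem_reaches cs p with h | h
      · refine (isLineGraph cs).swap.arrow_induction (fun p hp => hC p fun q hq => hp q ?_) h p.2 hk
        have hsw := @IsLineGraph.mem_lineMatching_swap _ (StepRight cs) (IsTop cs) (X'' cs)
        exact hq.imp hsw.2 fun ⟨h1, h2, h3⟩ => ⟨h1, h2.symm, fun h => h3 (hsw.1 h)⟩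
      · exact (isLineGraph cs).arrow_induction hC h p.2 hk
  exact ⟨fun p => key _ p rfl⟩

theorem finite_arrow (p : K'' cs) : {q | Arrow (matching cs) p q}.Finite := by
  refine (Set.Finite.union (s := {q | (p, q) ∈ matching cs}) (t := {q | q ⋖ p}) ?_ ?_).subset ?_
  · refine Set.Subsingleton.finite fun q hq r hr => ?_
    exact congrArg Prod.snd
      (eq_of_mem_of_mem (isMatching_matching cs) hq hr (Or.inl rfl) (Or.inl rfl))
  · refine ((finite_isFacet (p : (K cs).Cell)).preimage Subtype.val_injective.injOn).subset ?_
    exact fun q hq => (covBy_iff_isFacet (isLowerSet_K'' cs)).1 hq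
  · exact fun q hq => hq.imp_right And.left

theorem isAcyclic_matching : IsAcyclic (matching cs) :=
  isAcyclic_of_wellFounded (wellFounded_arrow cs) fun _ _ h => h

theorem isProper_matching : IsProper (matching cs) :=
  isProper_of_wellFounded (wellFounded_arrow cs) (fun _ _ h => h) (finite_arrow cs)

end DualCoxeter

theorem mainTheorem12 {n : ℕ} {M : CoxeterMatrix (Fin n)} {W : Type*} [Group W]
    (cs : CoxeterSystem M W) :
    IsLowerSet (DualCoxeter.K' cs) ∧
    IsLowerSet (DualCoxeter.K'' cs) ∧
    DualCoxeter.K' cs ⊆ DualCoxeter.K'' cs ∧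
    (∃ 𝓜 : Set (DualCoxeter.K'' cs × DualCoxeter.K'' cs),
      PosetMatching.IsMatching 𝓜 ∧
      (∀ e ∈ 𝓜, DualCoxeter.SameFiberComponent cs e.1 e.2) ∧
      (∀ e ∈ 𝓜, (DualCoxeter.K cs).IsRegularFace e.1 e.2) ∧
      PosetMatching.IsAcyclic 𝓜 ∧
      PosetMatching.IsProper 𝓜 ∧
      ∀ σ : DualCoxeter.K'' cs, PosetMatching.IsCritical 𝓜 σ ↔
        (σ : (DualCoxeter.K cs).Cell) ∈ DualCoxeter.K' cs) ∧
    DeformationRetractsOnto ((DualCoxeter.K cs).carrier (DualCoxeter.K'' cs))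
      ((DualCoxeter.K cs).carrier (DualCoxeter.K' cs)) :=
  have hreg := fun e he => DualCoxeter.isRegularFace_of_mem_matching cs (e := e) he
  ⟨DualCoxeter.isLowerSet_K' cs, DualCoxeter.isLowerSet_K'' cs, DualCoxeter.K'_subset_K'' cs,
    ⟨DualCoxeter.matching cs, DualCoxeter.isMatching_matching cs,
      fun _ he => DualCoxeter.sameFiberComponent_of_mem_matching cs he, hreg,
      DualCoxeter.isAcyclic_matching cs, DualCoxeter.isProper_matching cs,
      DualCoxeter.isCritical_matching_iff cs⟩,
    (DeltaComplex.Collapse.ofMatching (DualCoxeter.isLowerSet_K'' cs)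
      (DualCoxeter.isLowerSet_K' cs) (DualCoxeter.K'_subset_K'' cs)
      (DualCoxeter.isMatching_matching cs) hreg (DualCoxeter.isAcyclic_matching cs)
      (DualCoxeter.isProper_matching cs)
      (DualCoxeter.isCritical_matching_iff cs)).deformationRetractsOnto⟩
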